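/- Let $D$ be a diagram of an oriented link, let $p$ be a crossing of $D$, and let $D'$ be a diagram obtained from $D$ by lassoing at $p$: the crossing $p$ is changed (its over- and under-strand are exchanged), and a loop, oriented counterclockwise or clockwise, is added around $p$ which crosses the four ends of $p$ alternately over and under in such a way that the resulting five-crossing tangle is alternating. Let $\nabla(\,\cdot\,;z)$ denote the Conway polynomial, i.e. the invariant of oriented links with value $1$ on the trivial knot that satisfies $\nabla(D_+;z)-\nabla(D_-;z)=z\,\nabla(D_0;z)$. Then, for either orientation of the loop, $$\nabla(D';z)=-z^3\,\nabla(D;z)\quad\text{if } p \text{ is a negative crossing of } D,$$ $$\nabla(D';z)=z^3\,\nabla(D;z)\quad\text{if } p \text{ is a positive crossing of } D.$$ -/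

import Mathlib

open Polynomial

/-! ## Oriented link diagrams -/

/-- A passage through a crossing `c`: `(c, true)` is the overpassing branch of the oriented link at
`c`, and `(c, false)` is the underpassing one. -/
abbrev Passage (C : Type*) := C × Bool

/-- The combinatorial data (signed oriented Gauss code) of an oriented link diagram with set of
crossings `C`: the signs of the crossings (`1` positive, `-1` negative), the passage `next x` that
comes after the passage `x` when one follows the orientation of the link, and the number of
components that do not run through any crossing. The edge that leaves the crossing along the passage
`x` is called the edge `x`; it runs from `x` to `next x`. -/
structure GaussDiagram (C : Type*) where
  sign : C → ℤˣ
  next : Equiv.Perm (Passage C)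
  circles : ℕ

namespace GaussDiagram

variable {C : Type*}

/-- One step along the boundary of a region. The dart `(x, true)` is the edge that leaves along
the passage `x`, run through forwards; the dart `(x, false)` is the edge that enters along the
passage `x`, run through backwards: both start at the crossing `x.1`. With the region on the left
one goes to the far end of the edge, arriving there on the passage `y`, and turns left into the
other branch of that crossing. At a positive crossing the ends in counterclockwise order are:
over-in, under-in, over-out, under-out; at a negative one: under-in, over-in, under-out,
over-out. -/
def faceStep (D : GaussDiagram C) (d : Passage C × Bool) : Passage C × Bool :=
  let y := if d.2 then D.next d.1 else D.next.symm d.1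
  ((y.1, !y.2), (y.2 == d.2) == decide (D.sign y.1 = 1))

/-- The regions of the diagram: darts up to going around the boundary. -/
def Face (D : GaussDiagram C) : Type _ := Quot fun d e => D.faceStep d = e

/-- The connected pieces of the projection (apart from the crossingless circles): crossings up to
being joined by edges. -/
def Piece (D : GaussDiagram C) : Type _ := Quot fun c d => ∃ l, (D.next (c, l)).1 = d

/-- Euler's formula: the surface that is obtained by gluing discs to the projection along all
region boundaries is a union of spheres, one for each piece. As there are `2 * |C|` edges,
this is `V - E + F = 2 * (number of pieces)`. -/
def IsPlanar (D : GaussDiagram C) : Prop :=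
  Nat.card D.Face = Nat.card C + 2 * Nat.card D.Piece

end GaussDiagram

/-- An oriented link diagram (in the plane or on the sphere) with set of crossings `C`. -/
structure LinkDiagram (C : Type*) extends GaussDiagram C where
  planar : toGaussDiagram.IsPlanar

/-! ## The Conway polynomial -/

namespace GaussDiagram

variable {C : Type*} [DecidableEq C]

/-- Exchange of the two branches at all crossings in `S`. -/
def toggle (S : Finset C) : Equiv.Perm (Passage C) :=
  Function.Involutive.toPerm (fun x => if x.1 ∈ S then (x.1, !x.2) else x) (by
    rintro ⟨c, l⟩
    by_cases h : c ∈ S <;> simp [h])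

/-- The edges of `D` in the order in which the diagram `D_S` runs through them, where `D_S` is `D`
with all crossings in `S` smoothed according to the orientation: the edge `e` is followed
by the one that leaves along `next e`, and at a smoothed crossing by the one that leaves along the
other branch. -/
def walk (D : GaussDiagram C) (S : Finset C) : Equiv.Perm (Passage C) :=
  D.next.trans (toggle S)

/-- `D_S` has only one component. -/
def OneComponent (D : GaussDiagram C) (S : Finset C) : Prop :=
  D.circles = 0 ∧ ∀ e f : Passage C, (D.walk S).SameCycle e f

/-- Running through `D_S` from the edge `b` on, one arrives on the branch `x` of its crossing before
one arrives on the other branch. -/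
def First (D : GaussDiagram C) (S : Finset C) (b x : Passage C) : Prop :=
  ∃ k : ℕ, D.next ((D.walk S ^ k) b) = x ∧ ∀ j ≤ k, D.next ((D.walk S ^ j) b) ≠ (x.1, !x.2)

/-- Running through `D_S` from the edge `b` on, one arrives at every crossing in `R` for the first
time along its overpass. -/
def OverFirst (D : GaussDiagram C) (S R : Finset C) (b : Passage C) : Prop :=
  ∀ c ∈ R, D.First S b (c, true)

open Classical in
/-- The polynomial of the diagram `D_T` (`D` with the crossings in `T` smoothed), resolved from the
base edge `b` by the skein relation `∇(D₊) - ∇(D₋) = z ∇(D₀)`. Go along the diagram from `b`.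
Whenever a crossing is met for the first time, and on its overpass, replace the diagram by the one
with this crossing changed, plus `sign * z` times the one with this crossing smoothed. In the end
all diagrams are ascending from `b`: a trivial knot (value `1`) if there is only one component, a
split link (value `0`) otherwise. So what remains is the sum, over the sets `S` of
smoothed crossings that occur and give one component, of `(∏ signs) * z ^ |S|`. -/
noncomputable def skeinSum [Fintype C] (D : GaussDiagram C) (T : Finset C) (b : Passage C) : ℤ[X] :=
  ∑ S ∈ Tᶜ.powerset with D.OneComponent (T ∪ S) ∧ D.OverFirst (T ∪ S) S b,
    Polynomial.C (∏ c ∈ S, (D.sign c : ℤ)) * X ^ S.card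

/-- The diagram with the crossing `c` changed. -/
def change (D : GaussDiagram C) (c : C) : GaussDiagram C where
  sign := Function.update D.sign c (-D.sign c)
  next := ((toggle {c}).trans D.next).trans (toggle {c})
  circles := D.circles

end GaussDiagram

set_option linter.unusedSectionVars false

namespace GaussDiagram

variable {C : Type*} [DecidableEq C]

theorem toggle_apply (S : Finset C) (c : C) (l : Bool) :
    toggle S (c, l) = if c ∈ S then (c, !l) else (c, l) := rfl

theorem toggle_toggle (S : Finset C) (x : Passage C) : toggle S (toggle S x) = x :=
  (toggle S).left_inv x

theorem walk_change (D : GaussDiagram C) (c : C) (S : Finset C) (x : Passage C) :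
    (D.change c).walk S (toggle {c} x) = toggle {c} (D.walk S x) := by
  simp only [walk, change, Equiv.trans_apply, toggle_toggle]
  generalize D.next x = y
  obtain ⟨d, l⟩ := y
  by_cases h : d ∈ S <;> by_cases h' : d = c <;> (try subst h') <;> simp_all [toggle_apply]

theorem walk_pow_change (D : GaussDiagram C) (c : C) (S : Finset C) (k : ℕ) (x : Passage C) :
    ((D.change c).walk S ^ k) (toggle {c} x) = toggle {c} ((D.walk S ^ k) x) := by
  induction k with
  | zero => rfl
  | succ k ih => rw [pow_succ', pow_succ', Equiv.Perm.mul_apply, ih, walk_change]; rfl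

theorem walk_zpow_change (D : GaussDiagram C) (c : C) (S : Finset C) (k : ℤ) (x : Passage C) :
    ((D.change c).walk S ^ k) (toggle {c} x) = toggle {c} ((D.walk S ^ k) x) := by
  have h : (D.change c).walk S = toggle {c} * D.walk S * (toggle {c})⁻¹ := by
    ext1 x
    obtain ⟨y, rfl⟩ := (toggle {c}).surjective x
    simp [walk_change]
  rw [h, conj_zpow]
  simp

theorem next_walk_change (D : GaussDiagram C) (c : C) (S : Finset C) (k : ℕ) (x : Passage C) :
    (D.change c).next (((D.change c).walk S ^ k) (toggle {c} x)) =
      toggle {c} (D.next ((D.walk S ^ k) x)) := by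
  rw [walk_pow_change]
  simp [change, toggle_toggle]

theorem oneComponent_change (D : GaussDiagram C) (c : C) (S : Finset C) :
    (D.change c).OneComponent S ↔ D.OneComponent S := by
  refine and_congr Iff.rfl ?_
  rw [← (toggle {c}).forall_congr_right]
  refine forall_congr' fun e => ?_
  rw [← (toggle {c}).forall_congr_right]
  refine forall_congr' fun f => exists_congr fun k => ?_
  rw [walk_zpow_change, (toggle {c}).injective.eq_iff]

theorem first_change (D : GaussDiagram C) (c : C) (S : Finset C) (b x : Passage C) :
    (D.change c).First S (toggle {c} b) (toggle {c} x) ↔ D.First S b x := by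
  have h : ((toggle {c} x).1, !(toggle {c} x).2) = toggle {c} (x.1, !x.2) := by
    obtain ⟨d, l⟩ := x
    by_cases h' : d = c <;> simp [toggle_apply, h']
  simp only [First, next_walk_change, h, (toggle {c}).injective.eq_iff, ne_eq]

theorem first_not [Finite C] (D : GaussDiagram C) (S : Finset C) (b : Passage C) (c : C)
    (h : D.OneComponent S) : D.First S b (c, false) ↔ ¬ D.First S b (c, true) := by
  have hex : ∀ x, ∃ k : ℕ, D.next ((D.walk S ^ k) b) = x := by
    intro x
    obtain ⟨k, hk⟩ := (h.2 b (D.next.symm x)).exists_nat_pow_eq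
    exact ⟨k, by simp [hk]⟩
  classical
  obtain ⟨k, hk, hk'⟩ : ∃ k, D.next ((D.walk S ^ k) b) = (c, true) ∧
      ∀ j < k, D.next ((D.walk S ^ j) b) ≠ (c, true) :=
    ⟨_, Nat.find_spec (hex (c, true)), fun j hj => Nat.find_min (hex (c, true)) hj⟩
  obtain ⟨m, hm, hm'⟩ : ∃ k, D.next ((D.walk S ^ k) b) = (c, false) ∧
      ∀ j < k, D.next ((D.walk S ^ j) b) ≠ (c, false) :=
    ⟨_, Nat.find_spec (hex (c, false)), fun j hj => Nat.find_min (hex (c, false)) hj⟩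
  have hkm : k ≠ m := by rintro rfl; simp [hk] at hm
  constructor
  · rintro ⟨i, hi, hi'⟩ ⟨j, hj, hj'⟩
    rcases le_total i j with hij | hij
    · exact hj' i hij hi
    · exact hi' j hij hj
  · intro hn
    refine ⟨m, hm, fun j hj hj' => hn ⟨j, hj', fun i hi hi' => ?_⟩⟩
    have : ¬ i < m := fun h => hm' i h hi'
    have : j = m := by omega
    subst this
    simp [hj'] at hm

/-- The skein relation `∇(D₊) - ∇(D₋) = z ∇(D₀)`, for the polynomials that are resolved from a
base edge. -/
theorem skeinSum_sub_skeinSum_change [Fintype C] (D : GaussDiagram C) (c : C) (T : Finset C)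
    (hc : c ∉ T) (b : Passage C) :
    D.skeinSum T b - (D.change c).skeinSum T (toggle {c} b) =
      Polynomial.C (D.sign c : ℤ) * X * D.skeinSum (insert c T) b := by
  classical
  have hT : Tᶜ = insert c (insert c T)ᶜ := by
    ext d; by_cases h : d = c <;> simp_all
  have hc' : c ∉ (insert c T)ᶜ := by simp
  simp only [skeinSum, Finset.sum_filter]
  rw [hT, Finset.sum_powerset_insert hc', Finset.sum_powerset_insert hc', Finset.mul_sum,
    ← Finset.sum_add_distrib, ← Finset.sum_add_distrib, ← Finset.sum_sub_distrib]
  refine Finset.sum_congr rfl fun S hS => ?_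
  have hcS : c ∉ S := fun h => hc' (Finset.mem_powerset.1 hS h)
  have hne : ∀ d ∈ S, d ≠ c := by rintro d hd rfl; exact hcS hd
  have key : ∀ R, (D.change c).OverFirst R S (toggle {c} b) ↔ D.OverFirst R S b := by
    intro R
    simp only [OverFirst]
    refine forall₂_congr fun d hd => ?_
    rw [← first_change D c]
    simp [toggle_apply, hne d hd]
  have key2 : ∀ R, D.OneComponent R →
      ((D.change c).First R (toggle {c} b) (c, true) ↔ ¬ D.First R b (c, true)) := by
    intro R hR
    rw [← first_not D R b c hR, ← first_change D c]
    simp [toggle_apply]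
  have hins : ∀ (E : GaussDiagram C) R a, E.OverFirst R (insert c S) a ↔
      E.First R a (c, true) ∧ E.OverFirst R S a := by
    intro E R a
    simp [OverFirst]
  have hprod : ∏ d ∈ S, ((D.change c).sign d : ℤ) = ∏ d ∈ S, (D.sign d : ℤ) :=
    Finset.prod_congr rfl fun d hd => by simp [change, hne d hd]
  have hsc : ((D.change c).sign c : ℤ) = -(D.sign c : ℤ) := by simp [change]
  have hun : insert c T ∪ S = T ∪ insert c S := by ext; simp
  simp only [oneComponent_change, key, hins, hun, Finset.prod_insert hcS,
    Finset.card_insert_of_notMem hcS, hprod, hsc]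
  generalize T ∪ insert c S = R
  by_cases h1 : D.OneComponent R
  · simp only [key2 _ h1]
    by_cases h2 : D.First R b (c, true) <;> by_cases h3 : D.OverFirst R S b <;>
      simp [h1, h2, h3] <;> ring
  · simp [h1]

/-- The values at the ends of the resolution: if no crossing of `D_T` is met first on its overpass
by going from `b` (the diagram is ascending from `b`), one gets `1` for one component, and
`0` for several. -/
theorem skeinSum_of_ascending [Fintype C] (D : GaussDiagram C) (T : Finset C) (b : Passage C)
    (h : ∀ c ∉ T, ¬ D.First T b (c, true)) [Decidable (D.OneComponent T)] :
    D.skeinSum T b = if D.OneComponent T then 1 else 0 := by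
  classical
  rw [skeinSum, Finset.sum_filter, Finset.sum_eq_single ∅]
  · simp [OverFirst]
  · intro S hS hne
    rw [if_neg]
    rintro ⟨h1, h2⟩
    obtain ⟨c, hc⟩ := Finset.nonempty_iff_ne_empty.2 hne
    have hex : ∃ k : ℕ, (D.next ((D.walk (T ∪ S) ^ k) b)).1 ∈ S := by
      obtain ⟨k, hk, -⟩ := h2 c hc
      exact ⟨k, by rw [hk]; exact hc⟩
    obtain ⟨k, hk, hk'⟩ : ∃ k : ℕ, (D.next ((D.walk (T ∪ S) ^ k) b)).1 ∈ S ∧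
        ∀ j < k, (D.next ((D.walk (T ∪ S) ^ j) b)).1 ∉ S :=
      ⟨_, Nat.find_spec hex, fun j hj => Nat.find_min hex hj⟩
    have agree : ∀ j ≤ k, (D.walk T ^ j) b = (D.walk (T ∪ S) ^ j) b := by
      intro j
      induction j with
      | zero => intro _; rfl
      | succ j ih =>
        intro hj
        rw [pow_succ', pow_succ', Equiv.Perm.mul_apply, Equiv.Perm.mul_apply, ih (by omega)]
        have := hk' j (by omega)
        have ht : ∀ y : Passage C, y.1 ∉ S → toggle T y = toggle (T ∪ S) y := by
          rintro ⟨d, l⟩ hd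
          simp only at hd
          simp [toggle_apply, hd]
        exact ht _ this
    obtain ⟨i, hi, hi'⟩ := h2 _ hk
    have hki : k ≤ i := by
      by_contra hlt
      exact hk' i (by omega) (by rw [hi]; exact hk)
    have hx : D.next ((D.walk (T ∪ S) ^ k) b) =
        ((D.next ((D.walk (T ∪ S) ^ k) b)).1, true) := by
      have := hi' k hki
      revert this
      generalize D.next ((D.walk (T ∪ S) ^ k) b) = y
      obtain ⟨d, _ | _⟩ := y <;> simp
    refine h _ (Finset.mem_compl.1 (Finset.mem_powerset.1 hS hk))
      ⟨k, by rw [agree k le_rfl]; exact hx, fun j hj hj' => ?_⟩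
    rw [agree j hj] at hj'
    rcases hj.lt_or_eq with hlt | rfl
    · exact hk' j hlt (by rw [hj']; exact hk)
    · rw [hj'] at hx
      simp at hx
  · simp

end GaussDiagram

namespace LinkDiagram

variable {C : Type*} [DecidableEq C] [Fintype C]

open Classical in
/-- The Conway polynomial `∇` of the oriented link with diagram `D`, in the variable `X = z`: the
isotopy invariant with value `1` on the trivial knot and `∇(D₊) - ∇(D₋) = z ∇(D₀)`, computed by
resolving `D` with the skein relation from a base edge (see `GaussDiagram.skeinSum`,
`skeinSum_sub_skeinSum_change` and `skeinSum_of_ascending`). As `∇` is an invariant, all base edges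
of a link diagram give the same polynomial, and this common value is taken. If there are no
crossings, the link is trivial: the value is `1` for a knot, and `0` for several components. -/
noncomputable def conway (D : LinkDiagram C) : ℤ[X] :=
  if IsEmpty C then if D.circles = 1 then 1 else 0
  else if h : ∃ P : ℤ[X], ∀ b : Passage C, D.skeinSum ∅ b = P then h.choose else 0

end LinkDiagram

/-! ## Lassoing -/

namespace GaussDiagram

variable {C : Type*}

/-- The next crossing on the loop of a lasso, for a loop that runs through the ends in the order
over-in, under-in, over-out, under-out (`cyc = true`) or in the reverse order (`cyc = false`);
see `lasso` for the names of the ends. -/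
def loopNext (cyc : Bool) (a : Bool × Bool) : Bool × Bool := (!a.1, (a.2 ^^ !(a.1 == cyc)))

variable [DecidableEq C]

/-- The place in the lassoed diagram where one arrives instead of the passage `y`: at the crossing
`p` the loop is met first. -/
def lassoEnter (p : C) (y : Passage C) : Passage (C ⊕ Bool × Bool) :=
  if y.1 = p then (Sum.inr (y.2, false), y.2) else (Sum.inl y.1, y.2)

/-- The place in the lassoed diagram that is left instead of the passage `x`: at the crossing `p`
the loop is met last. -/
def lassoLeave (p : C) (x : Passage C) : Passage (C ⊕ Bool × Bool) :=
  if x.1 = p then (Sum.inr (x.2, true), x.2) else (Sum.inl x.1, x.2)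

/-- The order of passages in the lassoed diagram. -/
def lassoNext (D : GaussDiagram C) (p : C) (cyc : Bool) :
    Passage (C ⊕ Bool × Bool) → Passage (C ⊕ Bool × Bool)
  | (Sum.inl c, l) => if c = p then (Sum.inr (!l, true), !l) else lassoEnter p (D.next (c, l))
  | (Sum.inr (s, e), l) =>
    if l = s then (if e then lassoEnter p (D.next (p, s)) else (Sum.inl p, !s))
    else (Sum.inr (loopNext cyc (s, e)), s)

/-- The inverse of `lassoNext`. -/
def lassoPrev (D : GaussDiagram C) (p : C) (cyc : Bool) :
    Passage (C ⊕ Bool × Bool) → Passage (C ⊕ Bool × Bool)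
  | (Sum.inl c, l) =>
    if c = p then (Sum.inr (!l, false), !l) else lassoLeave p (D.next.symm (c, l))
  | (Sum.inr (s, e), l) =>
    if l = s then (if e then (Sum.inl p, !s) else lassoLeave p (D.next.symm (p, s)))
    else (Sum.inr (loopNext (!cyc) (s, e)), s)

theorem lassoPrev_lassoEnter (D : GaussDiagram C) (p : C) (cyc : Bool) (y : Passage C) :
    D.lassoPrev p cyc (lassoEnter p y) = lassoLeave p (D.next.symm y) := by
  obtain ⟨c, l⟩ := y
  by_cases h : c = p <;> simp [lassoEnter, lassoPrev, h]

theorem lassoNext_lassoLeave (D : GaussDiagram C) (p : C) (cyc : Bool) (x : Passage C) :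
    D.lassoNext p cyc (lassoLeave p x) = lassoEnter p (D.next x) := by
  obtain ⟨c, l⟩ := x
  by_cases h : c = p <;> simp [lassoLeave, lassoNext, h]

theorem lassoPrev_lassoNext (D : GaussDiagram C) (p : C) (cyc : Bool) :
    Function.LeftInverse (D.lassoPrev p cyc) (D.lassoNext p cyc) := by
  rintro ⟨c | ⟨s, e⟩, l⟩
  · by_cases h : c = p
    · simp [lassoNext, lassoPrev, h]
    · simp [lassoNext, h, lassoPrev_lassoEnter, lassoLeave]
  · have h1 : (loopNext cyc (s, e)).1 = !s := rfl
    by_cases h : l = s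
    · cases e
      · simp [lassoNext, lassoPrev, h]
      · simp only [lassoNext, h, if_true]
        simp [lassoPrev_lassoEnter, lassoLeave]
    · cases s <;> cases l <;> cases cyc <;> simp_all [lassoNext, lassoPrev, loopNext]

theorem lassoNext_lassoPrev (D : GaussDiagram C) (p : C) (cyc : Bool) :
    Function.RightInverse (D.lassoPrev p cyc) (D.lassoNext p cyc) := by
  rintro ⟨c | ⟨s, e⟩, l⟩
  · by_cases h : c = p
    · simp [lassoNext, lassoPrev, h]
    · simp [lassoPrev, h, lassoNext_lassoLeave, lassoEnter]
  · have h1 : (loopNext (!cyc) (s, e)).1 = !s := rfl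
    by_cases h : l = s
    · cases e
      · simp only [lassoPrev, h, if_true]
        simp [lassoNext_lassoLeave, lassoEnter]
      · simp [lassoNext, lassoPrev, h]
    · cases s <;> cases l <;> cases cyc <;> simp_all [lassoNext, lassoPrev, loopNext]

/-- Lassoing at the crossing `p`: the crossing `p` is changed, and a loop, oriented
counterclockwise or clockwise according to `ccw`, is added around it that crosses the four ends
of `p` alternately over and under, so that the whole tangle is alternating.

Let `s = true` stand for the branch that overpasses at `p` in `D`, and `s = false` for the other one.
The branch `s` meets first the crossing `inr (s, false)` with the loop, then `inl p`, then
the crossing `inr (s, true)` with the loop. At `p` it is now over if and only if `s = false`, hence it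
is over the loop if and only if `s = true`. -/
def lasso (D : GaussDiagram C) (p : C) (ccw : Bool) : GaussDiagram (C ⊕ Bool × Bool) where
  sign := Sum.elim (fun c => if c = p then -D.sign c else D.sign c)
    fun a => if (a.1 == a.2) = ccw then 1 else -1
  next :=
    { toFun := D.lassoNext p (decide (D.sign p = 1) == ccw)
      invFun := D.lassoPrev p (decide (D.sign p = 1) == ccw)
      left_inv := D.lassoPrev_lassoNext p _
      right_inv := D.lassoNext_lassoPrev p _ }
  circles := D.circles

end GaussDiagram

/-! The lassoed diagram is planar again. -/

namespace GaussDiagram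
variable {C : Type*} [DecidableEq C]

/-- The dart of the lassoed diagram that starts, outside of the lasso, as the dart `d`. -/
def lassoDart (p : C) (d : Passage C × Bool) : Passage (C ⊕ Bool × Bool) × Bool :=
  (if d.1.1 = p then (Sum.inr (d.1.2, d.2), d.1.2) else (Sum.inl d.1.1, d.1.2), d.2)

/-- The region to the left of a dart. -/
def face (D : GaussDiagram C) (d : Passage C × Bool) : D.Face := Quot.mk _ d

theorem face_faceStep (D : GaussDiagram C) (d : Passage C × Bool) :
    D.face (D.faceStep d) = D.face d :=
  (Quot.sound (r := fun d e => D.faceStep d = e) rfl).symm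

/-- The region of the lassoed diagram to the left of a dart: a region of `D`, or one of the
four triangles inside the lasso, which are named by their first end in counterclockwise order. -/
def lassoFace (D : GaussDiagram C) (p : C) (ccw : Bool) :
    Passage (C ⊕ Bool × Bool) × Bool → D.Face ⊕ Bool × Bool
  | ((Sum.inl c, l), f) =>
    if c = p then Sum.inr (!l, f)
    else Sum.inl (D.face ((c, l), f))
  | ((Sum.inr (s, e), l), f) =>
    if l = s then
      if e = f then Sum.inl (D.face ((p, s), f))
      else Sum.inr (loopNext (!decide (D.sign p = 1)) (s, e))
    else
      if f = ccw then Sum.inr (s, e)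
      else
        let b := loopNext (!decide (D.sign p = 1)) (s, e)
        Sum.inl (D.face ((p, b.1), b.2))

theorem lasso_next (D : GaussDiagram C) (p : C) (ccw : Bool) (x) :
    (D.lasso p ccw).next x = D.lassoNext p (decide (D.sign p = 1) == ccw) x := rfl

theorem lasso_next_symm (D : GaussDiagram C) (p : C) (ccw : Bool) (x) :
    (D.lasso p ccw).next.symm x = D.lassoPrev p (decide (D.sign p = 1) == ccw) x := rfl

theorem lasso_pos_of_ne (D : GaussDiagram C) (p : C) (ccw : Bool) {c : C} (h : c ≠ p) :
    decide ((D.lasso p ccw).sign (Sum.inl c) = 1) = decide (D.sign c = 1) := by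
  simp [lasso, h]

theorem lasso_pos_self (D : GaussDiagram C) (p : C) (ccw : Bool) :
    decide ((D.lasso p ccw).sign (Sum.inl p) = 1) = !decide (D.sign p = 1) := by
  rcases Int.units_eq_one_or (D.sign p) with h | h <;> simp [lasso, h]

theorem lasso_pos_inr (D : GaussDiagram C) (p : C) (ccw : Bool) (a : Bool × Bool) :
    decide ((D.lasso p ccw).sign (Sum.inr a) = 1) = ((a.1 == a.2) == ccw) := by
  by_cases h : (a.1 == a.2) = ccw <;> simp [lasso, h]

/-- Arriving from outside of the crossing of the branch `y.2` with the loop. -/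
theorem faceStep_enter (D : GaussDiagram C) (p : C) (ccw : Bool) (d : Passage C × Bool) :
    (D.lasso p ccw).faceStep (lassoDart p d) =
      (let y := if d.2 then D.next d.1 else D.next.symm d.1
       if y.1 = p then ((Sum.inr (y.2, !d.2), !y.2), !ccw) else lassoDart p (D.faceStep d)) := by
  obtain ⟨x, f⟩ := d
  cases f
  · have : (D.lasso p ccw).next.symm (lassoDart p (x, false)).1 = lassoLeave p (D.next.symm x) := by
      rw [lasso_next_symm]
      by_cases h : x.1 = p
      · subst h
        simp [lassoDart, lassoPrev]
      · simp [lassoDart, lassoPrev, h]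
    simp only [faceStep, lassoDart] at this ⊢
    simp only [Bool.false_eq_true, if_false, this]
    generalize D.next.symm x = y
    obtain ⟨c, l⟩ := y
    by_cases h : c = p
    · subst h
      simp only [lassoLeave, if_true, lasso_pos_inr]
      revert l ccw; simp
    · simp only [lassoLeave, h, if_false, lasso_pos_of_ne _ _ _ h]
  · have : (D.lasso p ccw).next (lassoDart p (x, true)).1 = lassoEnter p (D.next x) := by
      rw [lasso_next]
      by_cases h : x.1 = p
      · subst h
        simp [lassoDart, lassoNext]
      · simp [lassoDart, lassoNext, h]
    simp only [faceStep, lassoDart] at this ⊢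
    simp only [if_true, this]
    generalize D.next x = y
    obtain ⟨c, l⟩ := y
    by_cases h : c = p
    · subst h
      simp only [lassoEnter, if_true, lasso_pos_inr]
      revert l ccw; simp
    · simp only [lassoEnter, h, if_false, lasso_pos_of_ne _ _ _ h]

/-- Going clockwise along the outside of the loop. -/
theorem faceStep_outer (D : GaussDiagram C) (p : C) (ccw : Bool) (a : Bool × Bool) :
    (D.lasso p ccw).faceStep ((Sum.inr a, !a.1), !ccw) =
      (let b := loopNext (!decide (D.sign p = 1)) a
       ((Sum.inr b, b.1), b.2)) := by
  obtain ⟨s, e⟩ := a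
  simp only [faceStep, lasso_next, lasso_next_symm]
  rcases Int.units_eq_one_or (D.sign p) with hp | hp <;> cases s <;> cases e <;> cases ccw <;>
    simp [lassoNext, lassoPrev, loopNext, lasso_pos_inr, hp]

/-- Going counterclockwise along the inside of the loop. -/
theorem faceStep_inner (D : GaussDiagram C) (p : C) (ccw : Bool) (a : Bool × Bool) :
    (D.lasso p ccw).faceStep ((Sum.inr a, !a.1), ccw) =
      (let b := loopNext (decide (D.sign p = 1)) a
       ((Sum.inr b, b.1), !b.2)) := by
  obtain ⟨s, e⟩ := a
  simp only [faceStep, lasso_next, lasso_next_symm]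
  rcases Int.units_eq_one_or (D.sign p) with hp | hp <;> cases s <;> cases e <;> cases ccw <;>
    simp [lassoNext, lassoPrev, loopNext, lasso_pos_inr, hp]

/-- Going from the loop to the crossing `p`. -/
theorem faceStep_inward (D : GaussDiagram C) (p : C) (ccw : Bool) (a : Bool × Bool) :
    (D.lasso p ccw).faceStep ((Sum.inr a, a.1), !a.2) =
      (let b := loopNext (!decide (D.sign p = 1)) a
       ((Sum.inl p, !b.1), b.2)) := by
  obtain ⟨s, e⟩ := a
  have := lasso_pos_self D p ccw
  simp only [faceStep, lasso_next, lasso_next_symm]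
  rcases Int.units_eq_one_or (D.sign p) with hp | hp <;> cases s <;> cases e <;>
    simp_all [lassoNext, lassoPrev, loopNext]

/-- Going from the crossing `p` to the loop. -/
theorem faceStep_outward (D : GaussDiagram C) (p : C) (ccw : Bool) (a : Bool × Bool) :
    (D.lasso p ccw).faceStep ((Sum.inl p, !a.1), a.2) = ((Sum.inr a, !a.1), ccw) := by
  obtain ⟨s, e⟩ := a
  simp only [faceStep, lasso_next, lasso_next_symm]
  cases s <;> cases e <;> cases ccw <;> simp [lassoNext, lassoPrev, lasso_pos_inr]

theorem lasso_dart_cases (p : C) (ccw : Bool) {P : Passage (C ⊕ Bool × Bool) × Bool → Prop}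
    (dart : ∀ d, P (lassoDart p d)) (outer : ∀ a : Bool × Bool, P ((Sum.inr a, !a.1), !ccw))
    (inner : ∀ a : Bool × Bool, P ((Sum.inr a, !a.1), ccw))
    (inward : ∀ a : Bool × Bool, P ((Sum.inr a, a.1), !a.2))
    (outward : ∀ a : Bool × Bool, P ((Sum.inl p, !a.1), a.2)) (x) : P x := by
  have hb : ∀ a b : Bool, ¬ a = b → b = !a := by decide
  obtain ⟨⟨c | ⟨s, e⟩, l⟩, f⟩ := x
  · by_cases h : c = p
    · subst h
      simpa using outward (!l, f)
    · simpa [lassoDart, h] using dart ((c, l), f)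
  · by_cases h : l = s
    · subst h
      by_cases h' : e = f
      · subst h'
        simpa [lassoDart] using dart ((p, l), e)
      · rw [hb e f h']
        exact inward (l, e)
    · rw [hb s l (Ne.symm h)]
      by_cases h' : f = ccw
      · rw [h']
        exact inner (s, e)
      · rw [hb ccw f (Ne.symm h')]
        exact outer (s, e)

theorem lassoFace_dart (D : GaussDiagram C) (p : C) (ccw : Bool) (d : Passage C × Bool) :
    D.lassoFace p ccw (lassoDart p d) = Sum.inl (D.face d) := by
  obtain ⟨⟨c, l⟩, f⟩ := d
  by_cases h : c = p <;> simp [lassoDart, lassoFace, h]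

/-- Arriving at the crossing `p` in `D`. -/
theorem faceStep_of_eq (D : GaussDiagram C) (p : C) (d : Passage C × Bool)
    (h : (if d.2 then D.next d.1 else D.next.symm d.1).1 = p) :
    D.faceStep d =
      (let b := loopNext (!decide (D.sign p = 1))
        ((if d.2 then D.next d.1 else D.next.symm d.1).2, !d.2)
       ((p, b.1), b.2)) := by
  simp only [faceStep, h]
  generalize (if d.2 then D.next d.1 else D.next.symm d.1) = y
  cases hy : y.2 <;> cases d.2 <;>
    rcases Int.units_eq_one_or (D.sign p) with hp | hp <;> simp [loopNext, hp]

theorem lassoFace_faceStep (D : GaussDiagram C) (p : C) (ccw : Bool) (x) :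
    D.lassoFace p ccw ((D.lasso p ccw).faceStep x) = D.lassoFace p ccw x := by
  have hl : ∀ q a, loopNext (!q) (loopNext q a) = a := by decide
  have ho : ∀ a : Bool × Bool, D.lassoFace p ccw ((Sum.inr a, !a.1), !ccw) =
      (let b := loopNext (!decide (D.sign p = 1)) a
       Sum.inl (D.face ((p, b.1), b.2))) := by
    intro a
    simp [lassoFace]
  induction x using lasso_dart_cases p ccw with
  | dart d =>
    rw [faceStep_enter, lassoFace_dart, ← face_faceStep]
    dsimp only
    by_cases h : (if d.2 then D.next d.1 else D.next.symm d.1).1 = p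
    · rw [if_pos h, faceStep_of_eq D p d h]
      exact ho (_, _)
    · rw [if_neg h, lassoFace_dart]
  | outer a => rw [faceStep_outer]; simp [lassoFace]
  | inner a => rw [faceStep_inner]; simp [lassoFace, hl]
  | inward a => rw [faceStep_inward]; simp [lassoFace]
  | outward a => rw [faceStep_outward]; simp [lassoFace]

theorem face_lassoDart_faceStep (D : GaussDiagram C) (p : C) (ccw : Bool) (d : Passage C × Bool) :
    (D.lasso p ccw).face (lassoDart p (D.faceStep d)) = (D.lasso p ccw).face (lassoDart p d) := by
  symm
  rw [← face_faceStep, faceStep_enter]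
  dsimp only
  by_cases h : (if d.2 then D.next d.1 else D.next.symm d.1).1 = p
  · rw [if_pos h, ← face_faceStep]
    refine (congrArg _ (faceStep_outer D p ccw (_, _))).trans ?_
    rw [faceStep_of_eq D p d h]
    simp [lassoDart]
  · rw [if_neg h]

/-- The regions of the lassoed diagram are those of `D` and the four triangles. -/
def lassoFaceEquiv (D : GaussDiagram C) (p : C) (ccw : Bool) :
    (D.lasso p ccw).Face ≃ D.Face ⊕ Bool × Bool where
  toFun := Quot.lift (D.lassoFace p ccw) (by
    rintro x _ rfl
    exact (lassoFace_faceStep D p ccw x).symm)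
  invFun := Sum.elim
    (Quot.lift (fun d => (D.lasso p ccw).face (lassoDart p d)) (by
      rintro d _ rfl
      exact (face_lassoDart_faceStep D p ccw d).symm))
    (fun a => (D.lasso p ccw).face ((Sum.inr a, !a.1), ccw))
  left_inv := by
    rintro ⟨x⟩
    change Sum.elim _ _ (D.lassoFace p ccw x) = (D.lasso p ccw).face x
    induction x using lasso_dart_cases p ccw with
    | dart d => rw [lassoFace_dart]; rfl
    | outer a =>
      have h : D.lassoFace p ccw ((Sum.inr a, !a.1), !ccw) =
          (let b := loopNext (!decide (D.sign p = 1)) a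
           Sum.inl (D.face ((p, b.1), b.2))) := by
        simp [lassoFace]
      rw [← face_faceStep, faceStep_outer, h]
      change (D.lasso p ccw).face (lassoDart p _) = _
      simp [lassoDart]
    | inner a => simp [lassoFace]; rfl
    | inward a =>
      rw [← face_faceStep, faceStep_inward, ← face_faceStep, faceStep_outward]
      simp [lassoFace]; rfl
    | outward a =>
      rw [← face_faceStep, faceStep_outward]
      simp [lassoFace]; rfl
  right_inv := by
    rintro (d | a)
    · obtain ⟨d⟩ := d
      exact lassoFace_dart D p ccw d
    · change D.lassoFace p ccw ((Sum.inr a, !a.1), ccw) = _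
      simp [lassoFace]

theorem lasso_piece (D : GaussDiagram C) (p : C) (ccw : Bool) (c : C ⊕ Bool × Bool) (l : Bool) :
    (Quot.mk _ (c.elim id fun _ => p) : D.Piece) =
      Quot.mk _ (((D.lasso p ccw).next (c, l)).1.elim id fun _ => p) := by
  have he : ∀ y : Passage C, (lassoEnter p y).1.elim id (fun _ => p) = y.1 := by
    rintro ⟨d, m⟩
    by_cases h : d = p <;> simp [lassoEnter, h]
  rw [lasso_next]
  obtain c | ⟨s, e⟩ := c
  · by_cases h : c = p
    · simp [lassoNext, h]
    · simp only [lassoNext, h, if_false, he]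
      exact Quot.sound ⟨l, rfl⟩
  · by_cases h : l = s
    · cases e
      · simp [lassoNext, h]
      · simp only [lassoNext, h, if_true, he]
        exact Quot.sound ⟨s, rfl⟩
    · simp [lassoNext, h]

theorem lasso_piece_inr (D : GaussDiagram C) (p : C) (ccw : Bool) (a : Bool × Bool) :
    (Quot.mk _ (Sum.inr a) : (D.lasso p ccw).Piece) = Quot.mk _ (Sum.inl p) := by
  obtain ⟨s, _ | _⟩ := a
  · exact Quot.sound ⟨s, by simp [lasso_next, lassoNext]⟩
  · exact (Quot.sound ⟨!s, by simp [lasso_next, lassoNext]⟩).symm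

theorem lasso_piece_inl (D : GaussDiagram C) (p : C) (ccw : Bool) (c : C) (l : Bool) :
    (Quot.mk _ (Sum.inl c) : (D.lasso p ccw).Piece) = Quot.mk _ (Sum.inl (D.next (c, l)).1) := by
  have he : (Quot.mk _ (lassoEnter p (D.next (c, l))).1 : (D.lasso p ccw).Piece) =
      Quot.mk _ (Sum.inl (D.next (c, l)).1) := by
    by_cases h : (D.next (c, l)).1 = p
    · simp [lassoEnter, h, lasso_piece_inr]
    · simp [lassoEnter, h]
  rw [← he]
  by_cases h : c = p
  · subst h
    rw [← lasso_piece_inr D c ccw (l, true)]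
    exact Quot.sound ⟨l, by simp [lasso_next, lassoNext]⟩
  · exact Quot.sound ⟨l, by simp [lasso_next, lassoNext, h]⟩

/-- The pieces of the lassoed diagram are those of `D`. -/
def lassoPieceEquiv (D : GaussDiagram C) (p : C) (ccw : Bool) :
    (D.lasso p ccw).Piece ≃ D.Piece where
  toFun := Quot.lift (fun c => Quot.mk _ (c.elim id fun _ => p)) (by
    rintro c _ ⟨l, rfl⟩
    exact lasso_piece D p ccw c l)
  invFun := Quot.lift (fun c => Quot.mk _ (Sum.inl c)) (by
    rintro c _ ⟨l, rfl⟩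
    exact lasso_piece_inl D p ccw c l)
  left_inv := by
    rintro ⟨c | a⟩
    · rfl
    · exact (lasso_piece_inr D p ccw a).symm
  right_inv := by
    rintro ⟨c⟩
    rfl

theorem IsPlanar.lasso [Finite C] {D : GaussDiagram C} (h : D.IsPlanar) (p : C) (ccw : Bool) :
    (D.lasso p ccw).IsPlanar := by
  have : Finite D.Face := Quot.finite _
  rw [IsPlanar] at h ⊢
  rw [Nat.card_congr (D.lassoFaceEquiv p ccw), Nat.card_congr (D.lassoPieceEquiv p ccw),
    Nat.card_sum, Nat.card_sum, h]
  omega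

end GaussDiagram

/-- The diagram obtained from the link diagram `D` by lassoing at the crossing `p`, with the loop
oriented counterclockwise (`ccw = true`) or clockwise; see `GaussDiagram.lasso`. -/
def LinkDiagram.lasso {C : Type*} [DecidableEq C] [Fintype C] (D : LinkDiagram C) (p : C)
    (ccw : Bool) : LinkDiagram (C ⊕ Bool × Bool) where
  toGaussDiagram := D.toGaussDiagram.lasso p ccw
  planar := D.planar.lasso p ccw

/-!
The terms of the skein sum of the lassoed diagram `D'` are indexed by the sets of smoothed crossings.
Such a set consists of a set `S` of crossings of `D` other than `p` and a set `R` of crossings of the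
five-crossing tangle. If `R` is smoothed and no closed component remains inside the tangle, then the
two branches run through the tangle either as in `D`, or as in `D` with `p` smoothed
(`tangleCrossed`). Hence `D'` runs through the passages outside in the same order as `D` does,
with `S` and possibly `p` smoothed, and only inserts paths through the tangle
(`isPath_lassoInsertion`, `oneComponent_lasso_iff`). So whether a term counts is a condition on `S`,
which is the same as for `D`, and a condition on `R` that only depends on the order in which the
ends of the tangle are reached (`lasso_counts_iff`).

If the base edge lies outside of the lasso, the sum over `R` is finite and can be evaluated:
it is `ε z ^ 3`, where `ε` is the sign of `p`, times what the crossing `p` contributes in `D`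
(`tangleSum_through`). So the skein sums of `D'` and `D` differ by this factor
(`skeinSum_lasso_of_next_eq`).

If the base edge lies inside of the lasso, the terms of `D'` are grouped by the end at which one
leaves the tangle first. The sums over `S` that occur (`outerSum`) are also those that make up the
skein sums of `D` for the four edges at `p`. That these four agree gives linear relations between the
sums over `S`, and with them two more identities for the tangle (`tangleSum_fromInside_uncrossed`,
`tangleSum_fromInside_crossed`) give the same factor (`skeinSum_lasso_of_forall_eq`).

Consequently, all base edges of `D'` give one polynomial exactly if all base edges of `D` do, and
these polynomials differ by the factor `ε z ^ 3`.
-/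

/-! ### Orbits of permutations -/

/-- Iterating `g` from `a` on, one meets `x`, and does not meet `y` up to then. -/
def Before {α : Type*} (g : Equiv.Perm α) (x y a : α) : Prop :=
  ∃ k : ℕ, (g ^ k) a = x ∧ ∀ j ≤ k, (g ^ j) a ≠ y

/-- The list `l` runs through `a, g a, g (g a), …`, and `b` is the element that comes after it. -/
def IsPath {α : Type*} (g : Equiv.Perm α) : α → List α → α → Prop
  | a, [], b => a = b
  | a, z :: l, b => a = z ∧ IsPath g (g a) l b

section Orbits

variable {α : Type*} {g : Equiv.Perm α} {x y a b : α}

theorem before_self (h : x ≠ y) : Before g x y x := ⟨0, rfl, by simpa using h⟩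

theorem not_before_self : ¬ Before g x y y := fun ⟨_, _, h⟩ => h 0 (Nat.zero_le _) rfl

theorem before_iff_apply (hx : a ≠ x) (hy : a ≠ y) : Before g x y a ↔ Before g x y (g a) := by
  constructor
  · rintro ⟨_ | k, hk, hk'⟩
    · exact absurd hk hx
    · refine ⟨k, by rw [← hk, pow_succ, Equiv.Perm.mul_apply], fun j hj => ?_⟩
      rw [← Equiv.Perm.mul_apply, ← pow_succ]
      exact hk' (j + 1) (by omega)
  · rintro ⟨k, hk, hk'⟩
    refine ⟨k + 1, by rw [← hk, pow_succ, Equiv.Perm.mul_apply], ?_⟩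
    rintro (_ | j) hj
    · exact hy
    · rw [pow_succ, Equiv.Perm.mul_apply]
      exact hk' j (by omega)

theorem Before.not_before_swap (h : Before g x y a) : ¬ Before g y x a := by
  obtain ⟨i, hi, hi'⟩ := h
  rintro ⟨j, hj, hj'⟩
  rcases le_total i j with hij | hij
  · exact hj' i hij hi
  · exact hi' j hij hj

theorem before_or_before_swap [Finite α] (hg : ∀ a b, g.SameCycle a b) (hxy : x ≠ y) (a : α) :
    Before g x y a ∨ Before g y x a := by
  classical
  have hex : ∃ k : ℕ, (g ^ k) a = x ∨ (g ^ k) a = y := by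
    obtain ⟨k, hk⟩ := (hg a x).exists_nat_pow_eq
    exact ⟨k, Or.inl hk⟩
  have hmin : ∀ j < Nat.find hex, ¬ ((g ^ j) a = x ∨ (g ^ j) a = y) :=
    fun j hj => Nat.find_min hex hj
  rcases Nat.find_spec hex with h | h
  · refine Or.inl ⟨_, h, fun j hj hj' => ?_⟩
    rcases hj.lt_or_eq with hlt | rfl
    · exact hmin j hlt (Or.inr hj')
    · exact hxy (h.symm.trans hj')
  · refine Or.inr ⟨_, h, fun j hj hj' => ?_⟩
    rcases hj.lt_or_eq with hlt | rfl
    · exact hmin j hlt (Or.inl hj')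
    · exact hxy (hj'.symm.trans h)

theorem before_swap_iff [Finite α] (hg : ∀ a b, g.SameCycle a b) (hxy : x ≠ y) (a : α) :
    Before g y x a ↔ ¬ Before g x y a :=
  ⟨fun h => h.not_before_swap, (before_or_before_swap hg hxy a).resolve_left⟩

/-- Right after `y`, a transitive permutation meets `x` before it is back at `y`. -/
theorem before_apply [Finite α] (hg : ∀ a b, g.SameCycle a b) (hxy : x ≠ y) :
    Before g x y (g y) := by
  classical
  have hex : ∃ k : ℕ, (g ^ k) y = x := (hg y x).exists_nat_pow_eq
  -- If `y` came back within the minimal time, then that time could be shortened.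
  obtain ⟨k, hk, hmin⟩ : ∃ k : ℕ, (g ^ k) y = x ∧ ∀ j < k, (g ^ j) y ≠ x :=
    ⟨_, Nat.find_spec hex, fun j hj => Nat.find_min hex hj⟩
  obtain _ | k := k
  · exact absurd hk.symm hxy
  refine ⟨k, by rw [← hk, pow_succ, Equiv.Perm.mul_apply], fun j hj hj' => ?_⟩
  rw [← Equiv.Perm.mul_apply, ← pow_succ] at hj'
  refine hmin (k - j) (by omega) ?_
  rw [← hk, show k + 1 = (k - j) + (j + 1) by omega, pow_add, Equiv.Perm.mul_apply, hj']

theorem IsPath.before_iff {l : List α} : ∀ {a : α}, IsPath g a l b → x ∉ l → y ∉ l →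
    (Before g x y a ↔ Before g x y b) := by
  induction l with
  | nil => rintro a rfl _ _; rfl
  | cons z l ih =>
    rintro _ ⟨rfl, h⟩ hx hy
    simp only [List.mem_cons, not_or] at hx hy
    rw [before_iff_apply (Ne.symm hx.1) (Ne.symm hy.1), ih h hx.2 hy.2]

theorem IsPath.sameCycle {l : List α} : ∀ {a : α}, IsPath g a l b → g.SameCycle a b := by
  induction l with
  | nil => rintro a rfl; rfl
  | cons z l ih =>
    rintro _ ⟨rfl, h⟩
    exact Equiv.Perm.sameCycle_apply_left.1 (ih h)

theorem IsPath.sameCycle_of_mem {l : List α} : ∀ {a : α}, IsPath g a l b → ∀ z ∈ l,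
    g.SameCycle a z := by
  induction l with
  | nil => simp
  | cons z l ih =>
    rintro _ ⟨rfl, h⟩ w hw
    rcases List.mem_cons.1 hw with rfl | hw
    · rfl
    · exact Equiv.Perm.sameCycle_apply_left.1 (ih h w hw)

end Orbits

/-! ### Inserting paths into the orbits of a permutation -/

section Insertion

variable {α β : Type*} {g : Equiv.Perm α} {g' : Equiv.Perm β} {φ : α → β} {l : α → List β}

theorem iterate_mem_insertion (hp : ∀ x, IsPath g' (φ x) (φ x :: l x) (φ (g x))) (a : α) (k : ℕ) :
    ∃ x, g.SameCycle a x ∧ (g' ^ k) (φ a) ∈ φ x :: l x := by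
  suffices h : ∃ x, g.SameCycle a x ∧ ∃ z m, z :: m <:+ φ x :: l x ∧
      IsPath g' ((g' ^ k) (φ a)) (z :: m) (φ (g x)) by
    obtain ⟨x, hx, z, m, hs, h⟩ := h
    exact ⟨x, hx, h.1 ▸ hs.subset (by simp)⟩
  induction k with
  | zero => exact ⟨a, .refl _ _, _, _, List.suffix_refl _, hp a⟩
  | succ k ih =>
    obtain ⟨x, hx, z, m, hs, h⟩ := ih
    rw [pow_succ', Equiv.Perm.mul_apply]
    obtain _ | ⟨z', m⟩ := m
    · refine ⟨g x, Equiv.Perm.sameCycle_apply_right.2 hx, _, _, List.suffix_refl _, ?_⟩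
      rw [show g' ((g' ^ k) (φ a)) = φ (g x) from h.2]
      exact hp _
    · exact ⟨x, hx, z', m, (List.suffix_cons _ _).trans hs, h.2⟩

/-- If `g'` arises from `g` by the insertion of a path after each element, then `g'` is transitive
if and only if `g` is transitive and the paths exhaust all elements. -/
theorem sameCycle_insertion_iff [Finite β] (hφ : Function.Injective φ)
    (hp : ∀ x, IsPath g' (φ x) (φ x :: l x) (φ (g x))) (hl : ∀ x y, φ y ∉ l x) [Nonempty α] :
    (∀ a b, g'.SameCycle a b) ↔ (∀ a b, g.SameCycle a b) ∧ ∀ b, ∃ x, b ∈ φ x :: l x := by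
  constructor
  · refine fun h => ⟨fun a b => ?_, fun b => ?_⟩
    · obtain ⟨k, hk⟩ := (h (φ a) (φ b)).exists_nat_pow_eq
      obtain ⟨x, hx, hmem⟩ := iterate_mem_insertion hp a k
      rw [hk] at hmem
      rcases List.mem_cons.1 hmem with h | h
      · exact hφ h ▸ hx
      · exact absurd h (hl x b)
    · obtain ⟨a⟩ := ‹Nonempty α›
      obtain ⟨k, hk⟩ := (h (φ a) b).exists_nat_pow_eq
      obtain ⟨x, -, hmem⟩ := iterate_mem_insertion hp a k
      exact ⟨x, hk ▸ hmem⟩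
  · rintro ⟨h, hex⟩ a b
    have key : ∀ (k : ℕ) (x : α), g'.SameCycle (φ x) (φ ((g ^ k) x)) := by
      intro k x
      induction k with
      | zero => rfl
      | succ k ih =>
        rw [pow_succ', Equiv.Perm.mul_apply]
        exact ih.trans (hp _).sameCycle
    obtain ⟨x, hx⟩ := hex a
    obtain ⟨y, hy⟩ := hex b
    have : Finite α := Finite.of_injective φ hφ
    obtain ⟨k, hk⟩ := (h x y).exists_nat_pow_eq
    exact ((hp x).sameCycle_of_mem a hx).symm.trans
      ((hk ▸ key k x).trans ((hp y).sameCycle_of_mem b hy))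

theorem Before.insertion (hφ : Function.Injective φ)
    (hp : ∀ x, IsPath g' (φ x) (φ x :: l x) (φ (g x))) (hl : ∀ x y, φ y ∉ l x) {x y a : α}
    (hxy : x ≠ y) (h : Before g x y a) : Before g' (φ x) (φ y) (φ a) := by
  obtain ⟨k, hk, hk'⟩ := h
  induction k generalizing a with
  | zero =>
    obtain rfl : a = x := hk
    exact before_self (hφ.ne hxy)
  | succ k ih =>
    by_cases hax : a = x
    · rw [hax]; exact before_self (hφ.ne hxy)
    have hay : a ≠ y := hk' 0 (Nat.zero_le _)
    refine ((hp a).before_iff (by simpa [hφ.eq_iff, Ne.symm hax] using hl a x)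
      (by simpa [hφ.eq_iff, hay.symm] using hl a y)).2 (ih ?_ fun j hj => ?_)
    · rw [← hk, pow_succ, Equiv.Perm.mul_apply]
    · rw [← Equiv.Perm.mul_apply, ← pow_succ]
      exact hk' (j + 1) (by omega)

theorem before_insertion_iff [Finite β] (hφ : Function.Injective φ)
    (hp : ∀ x, IsPath g' (φ x) (φ x :: l x) (φ (g x))) (hl : ∀ x y, φ y ∉ l x)
    (hg : ∀ a b, g.SameCycle a b) {x y a : α} (hxy : x ≠ y) :
    Before g' (φ x) (φ y) (φ a) ↔ Before g x y a := by
  have : Finite α := Finite.of_injective φ hφ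
  refine ⟨fun h => ?_, .insertion hφ hp hl hxy⟩
  by_contra hn
  exact h.not_before_swap (((before_swap_iff hg hxy a).2 hn).insertion hφ hp hl hxy.symm)

end Insertion

/-! ### The five-crossing tangle of a lasso -/

namespace GaussDiagram

/-- The crossings of the tangle that replaces the crossing `p`: `none` is `p` itself, and `some a`
is the crossing `inr a` of the loop with one of the branches of `p`. -/
abbrev TangleCrossing := Option (Bool × Bool)

/-- The passage on which the branch `s` of `p` arrives at the tangle. -/
def tangleEntry (s : Bool) : Passage TangleCrossing := (some (s, false), s)

/-- The passage at which one arrives after the passage `x`, if the crossings in `S` are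
smoothed: `inl y` if this is the passage `y` of the tangle, and `inr f` if one leaves the tangle
along the branch `f`. The loop has the direction `cyc` as in `loopNext`. -/
def tangleStep (cyc : Bool) (S : Finset TangleCrossing) (x : Passage TangleCrossing) :
    Passage TangleCrossing ⊕ Bool :=
  match toggle S x with
  | (none, l) => Sum.inl (some (!l, true), !l)
  | (some (s, e), l) =>
    if l = s then if e then Sum.inr s else Sum.inl (none, !s)
    else Sum.inl (some (loopNext cyc (s, e)), s)

/-- The first `n` passages of the walk from `x` on, including `x`, or fewer of them if one leaves
the tangle; in the latter case, also the branch along which one leaves it. -/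
def tangleWalk (cyc : Bool) (S : Finset TangleCrossing) :
    ℕ → Passage TangleCrossing → List (Passage TangleCrossing) × Option Bool
  | 0, _ => ([], none)
  | n + 1, x =>
    match tangleStep cyc S x with
    | Sum.inl y => (x :: (tangleWalk cyc S n y).1, (tangleWalk cyc S n y).2)
    | Sum.inr f => ([x], some f)

/-- The walk through the tangle from `x` on. As there are only ten passages, one has left the tangle
after ten steps, or never leaves it. -/
abbrev tanglePath (cyc : Bool) (S : Finset TangleCrossing) (x : Passage TangleCrossing) :=
  tangleWalk cyc S 10 x

/-- The branch that enters along one end of `p` leaves along the end that belongs to the other one,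
as in the diagram in which `p` is smoothed. -/
def tangleCrossed (cyc : Bool) (S : Finset TangleCrossing) : Bool :=
  (tanglePath cyc S (tangleEntry true)).2 == some false

/-- The two paths through the tangle use all passages: no closed component remains inside. -/
def TangleFull (cyc : Bool) (S : Finset TangleCrossing) : Prop :=
  ∀ x, ∃ s, x ∈ (tanglePath cyc S (tangleEntry s)).1

instance (cyc S) : Decidable (TangleFull cyc S) := by unfold TangleFull; infer_instance

/-- The list `l` meets each crossing in `S`, and meets it first on its overpass. -/
def ListOverFirst (S : Finset TangleCrossing) (l : List (Passage TangleCrossing)) : Prop :=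
  ∀ c ∈ S, l.find? (fun z => z.1 = c) = some (c, true)

instance (S l) : Decidable (ListOverFirst S l) := by unfold ListOverFirst; infer_instance

/-- The passages in the order in which they are met if one enters the tangle first on the branch
`e`, and then on the other one. -/
def tangleRound (cyc : Bool) (S : Finset TangleCrossing) (e : Bool) :
    List (Passage TangleCrossing) :=
  (tanglePath cyc S (tangleEntry e)).1 ++ (tanglePath cyc S (tangleEntry !e)).1

theorem tanglePath_entry_snd : ∀ cyc S s,
    (tanglePath cyc S (tangleEntry s)).2 = some (s ^^ tangleCrossed cyc S) := by
  decide +kernel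

theorem tanglePath_entry_fst : ∀ cyc S s, (tanglePath cyc S (tangleEntry s)).1 =
    tangleEntry s :: (tanglePath cyc S (tangleEntry s)).1.tail := by
  decide +kernel

theorem tangleEntry_notMem_tail : ∀ cyc S s t,
    tangleEntry t ∉ (tanglePath cyc S (tangleEntry s)).1.tail := by
  decide +kernel

theorem TangleFull.exists_exit : ∀ {cyc S}, TangleFull cyc S → ∀ x,
    ∃ f, (tanglePath cyc S x).2 = some f := by
  decide +kernel

theorem TangleFull.exists_find {cyc S} (h : TangleFull cyc S) (e : Bool) (c : TangleCrossing) :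
    ∃ l, (tangleRound cyc S e).find? (fun z => z.1 = c) = some (c, l) := by
  obtain ⟨s, hs⟩ := h (c, true)
  have hmem : (c, true) ∈ tangleRound cyc S e := by
    by_cases he : s = e
    · exact List.mem_append_left _ (he ▸ hs)
    · exact List.mem_append_right _ ((Bool.eq_not_of_ne he) ▸ hs)
  cases hz : (tangleRound cyc S e).find? (fun z => z.1 = c) with
  | none => simpa using List.find?_eq_none.1 hz _ hmem
  | some z =>
    have : z.1 = c := by simpa using List.find?_some hz
    exact ⟨z.2, by rw [← this]⟩

/-! ### The skein sums of the tangle -/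

/-- The sign `1` or `-1` of a crossing that is positive or not. -/
def boolSign (pos : Bool) : ℤ := if pos then 1 else -1

/-- The signs in the lassoed diagram, where `pos` tells whether `p` is positive before it is
changed. -/
def tangleSign (pos ccw : Bool) (c : TangleCrossing) : ℤ :=
  c.elim (boolSign !pos) fun a => boolSign ((a.1 == a.2) == ccw)

/-- The number of smoothing states of the tangle with property `P` and `k` smoothed crossings,
counted with the product of the signs of these. -/
def tangleCoeff (pos ccw : Bool) (P : Finset TangleCrossing → Prop) [DecidablePred P] (k : ℕ) : ℤ :=
  ∑ S with S.card = k ∧ P S, ∏ c ∈ S, tangleSign pos ccw c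

/-- The factor that the crossings in `S` contribute to a term of the skein sum. -/
noncomputable def tangleWeight (pos ccw : Bool) (S : Finset TangleCrossing) : ℤ[X] :=
  Polynomial.C (∏ c ∈ S, tangleSign pos ccw c) * X ^ S.card

/-- The contribution of the smoothing states of the tangle with property `P`. -/
noncomputable def tangleSum (pos ccw : Bool) (P : Finset TangleCrossing → Prop) [DecidablePred P] :
    ℤ[X] :=
  ∑ S with P S, tangleWeight pos ccw S

/-- The states that count for a base edge outside of the tangle, if the branches are connected as
`d` says (in the sense of `tangleCrossed`) and the tangle is entered first on the branch `e`. -/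
def Through (cyc d e : Bool) (S : Finset TangleCrossing) : Prop :=
  TangleFull cyc S ∧ tangleCrossed cyc S = d ∧ ListOverFirst S (tangleRound cyc S e)

instance (cyc d e S) : Decidable (Through cyc d e S) := by unfold Through; infer_instance

/-- The states that count for a base edge that arrives at the passage `x` of the tangle, if the
branches are connected as `d` says and the tangle is left first along the branch `f`. If the whole
diagram has one component, then one comes back on the branch that does not lead to the same end:
this is the branch `!(f ^^ d)`. -/
def FromInside (cyc d f : Bool) (x : Passage TangleCrossing) (S : Finset TangleCrossing) : Prop :=
  TangleFull cyc S ∧ tangleCrossed cyc S = d ∧ (tanglePath cyc S x).2 = some f ∧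
    ListOverFirst S ((tanglePath cyc S x).1 ++ tangleRound cyc S !(f ^^ d))

instance (cyc d f x S) : Decidable (FromInside cyc d f x S) := by unfold FromInside; infer_instance

theorem coeff_tangleSum (pos ccw : Bool) (P : Finset TangleCrossing → Prop) [DecidablePred P]
    (k : ℕ) : (tangleSum pos ccw P).coeff k = tangleCoeff pos ccw P k := by
  simp only [tangleSum, tangleWeight, tangleCoeff, Polynomial.finsetSum_coeff,
    Polynomial.coeff_C_mul_X_pow]
  rw [Finset.sum_filter, Finset.sum_filter]
  refine Finset.sum_congr rfl fun S _ => ?_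
  by_cases h : P S <;> by_cases h' : k = S.card <;> simp [h, h', eq_comm]

theorem tangleCoeff_of_le (pos ccw : Bool) (P : Finset TangleCrossing → Prop) [DecidablePred P]
    {k : ℕ} (hk : 6 ≤ k) : tangleCoeff pos ccw P k = 0 := by
  refine Finset.sum_eq_zero fun S hS => ?_
  have h : S.card ≤ Fintype.card TangleCrossing := Finset.card_le_univ S
  simp only [Finset.mem_filter] at hS
  simp at h
  omega

theorem tangleCoeff_through_uncrossed : ∀ pos ccw e : Bool, ∀ k < 6,
    tangleCoeff pos ccw (Through (pos == ccw) false e) k = if k = 3 then boolSign pos else 0 := by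
  decide +kernel

theorem tangleCoeff_through_crossed : ∀ pos ccw e : Bool, ∀ k < 6,
    tangleCoeff pos ccw (Through (pos == ccw) true e) k = if k = 4 ∧ e then 1 else 0 := by
  decide +kernel

theorem tangleCoeff_fromInside_uncrossed : ∀ (pos ccw : Bool) (x), ∀ k < 6,
    tangleCoeff pos ccw (FromInside (pos == ccw) false true x) k +
      tangleCoeff pos ccw (FromInside (pos == ccw) false false x) k =
      if k = 3 then boolSign pos else 0 := by
  decide +kernel

theorem tangleCoeff_fromInside_crossed : ∀ (pos ccw : Bool) (x), ∀ k < 6,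
    tangleCoeff pos ccw (FromInside (pos == ccw) true true x) (k + 1) +
      tangleCoeff pos ccw (FromInside (pos == ccw) true false x) (k + 1) +
      boolSign pos * tangleCoeff pos ccw (FromInside (pos == ccw) false false x) k =
      if k = 3 then 1 else 0 := by
  decide +kernel

theorem tangleCoeff_fromInside_zero : ∀ (pos ccw : Bool) (x),
    tangleCoeff pos ccw (FromInside (pos == ccw) true true x) 0 +
      tangleCoeff pos ccw (FromInside (pos == ccw) true false x) 0 = 0 := by
  decide +kernel

/-- Up to the factor `± z ^ 3`, the tangle contributes as much as the crossing `p` does: `1` if the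
two branches go straight on; if they turn, the sign of `p` times `z` or `0`, according to whether
`p` is met first on its overpass. -/
theorem tangleSum_through (pos ccw d e : Bool) :
    tangleSum pos ccw (Through (pos == ccw) d e) = Polynomial.C (boolSign pos) * X ^ 3 *
      if d then if e then Polynomial.C (boolSign pos) * X else 0 else 1 := by
  have hs : Polynomial.C (boolSign pos) * X ^ 3 * (Polynomial.C (boolSign pos) * X) =
      (X ^ 4 : ℤ[X]) := by
    cases pos <;> simp [boolSign] <;> ring
  ext k
  rw [coeff_tangleSum]
  rcases lt_or_ge k 6 with hk | hk
  · cases d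
    · rw [tangleCoeff_through_uncrossed _ _ _ _ hk]
      simp [Polynomial.coeff_X_pow]
    · rw [tangleCoeff_through_crossed _ _ _ _ hk]
      cases e <;> simp only [Bool.false_eq_true, if_true, if_false, hs] <;>
        simp [Polynomial.coeff_X_pow]
  · rw [tangleCoeff_of_le _ _ _ hk]
    have h3 : k ≠ 3 := by omega
    have h4 : k ≠ 4 := by omega
    cases d <;> cases e <;> simp only [Bool.false_eq_true, if_true, if_false, hs] <;>
      simp [Polynomial.coeff_X_pow, h3, h4]

/-- One of the two identities for a base edge inside of the tangle. If the sums outside are `Q` for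
`d = false`, `f = true`, and `Q + ε z Y` for `d = false`, `f = false`, and `Y` for `d = true`, then
this identity gives the coefficient `ε z ^ 3` of `Q`, and the next one the coefficient `z ^ 4` of `Y`.
The total is `ε z ^ 3 * (Q + ε z Y)`. -/
theorem tangleSum_fromInside_uncrossed (pos ccw : Bool) (x) :
    tangleSum pos ccw (FromInside (pos == ccw) false true x) +
      tangleSum pos ccw (FromInside (pos == ccw) false false x) =
      Polynomial.C (boolSign pos) * X ^ 3 := by
  ext k
  rw [Polynomial.coeff_add, coeff_tangleSum, coeff_tangleSum]
  rcases lt_or_ge k 6 with hk | hk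
  · rw [tangleCoeff_fromInside_uncrossed _ _ _ _ hk]
    simp [Polynomial.coeff_X_pow]
  · rw [tangleCoeff_of_le _ _ _ hk, tangleCoeff_of_le _ _ _ hk]
    simp [Polynomial.coeff_X_pow, show k ≠ 3 by omega]

/-- See `tangleSum_fromInside_uncrossed`. -/
theorem tangleSum_fromInside_crossed (pos ccw : Bool) (x) :
    tangleSum pos ccw (FromInside (pos == ccw) true true x) +
      tangleSum pos ccw (FromInside (pos == ccw) true false x) +
      Polynomial.C (boolSign pos) *
        (X * tangleSum pos ccw (FromInside (pos == ccw) false false x)) = X ^ 4 := by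
  ext (_ | k)
  · simp [coeff_tangleSum, tangleCoeff_fromInside_zero]
  · simp only [Polynomial.coeff_add, Polynomial.coeff_C_mul, Polynomial.coeff_X_mul,
      coeff_tangleSum]
    rcases lt_or_ge k 6 with hk | hk
    · rw [tangleCoeff_fromInside_crossed _ _ _ _ hk]
      simp [Polynomial.coeff_X_pow]
    · rw [tangleCoeff_of_le _ _ _ (by omega), tangleCoeff_of_le _ _ _ (by omega),
        tangleCoeff_of_le _ _ _ hk]
      simp [Polynomial.coeff_X_pow, show k ≠ 3 by omega]

end GaussDiagram

/-! ### Skein sums in terms of arrivals -/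

namespace GaussDiagram

variable {C : Type*} [DecidableEq C]

/-- The passages in the order in which one arrives at them in `D_S`. This is the permutation `walk`
for the other way of naming an edge, by the passage to which it leads. -/
def arrive (D : GaussDiagram C) (S : Finset C) : Equiv.Perm (Passage C) :=
  (toggle S).trans D.next

theorem arrive_apply (D : GaussDiagram C) (S : Finset C) (x : Passage C) :
    D.arrive S x = D.next (toggle S x) := rfl

theorem next_walk_pow (D : GaussDiagram C) (S : Finset C) (k : ℕ) (b : Passage C) :
    D.next ((D.walk S ^ k) b) = (D.arrive S ^ k) (D.next b) := by
  induction k generalizing b with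
  | zero => rfl
  | succ k ih => rw [pow_succ, pow_succ, Equiv.Perm.mul_apply, Equiv.Perm.mul_apply, ih]; rfl

theorem first_iff_before (D : GaussDiagram C) (S : Finset C) (b : Passage C) (c : C) (l : Bool) :
    D.First S b (c, l) ↔ Before (D.arrive S) (c, l) (c, !l) (D.next b) := by
  simp only [First, Before, next_walk_pow]

theorem oneComponent_iff_arrive (D : GaussDiagram C) (S : Finset C) :
    D.OneComponent S ↔ D.circles = 0 ∧ ∀ x y, (D.arrive S).SameCycle x y := by
  refine and_congr Iff.rfl ?_
  have h : D.arrive S = D.next * D.walk S * D.next⁻¹ := by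
    ext1 x
    simp [arrive, walk]
  simp only [h, Equiv.Perm.sameCycle_conj]
  refine ⟨fun h x y => h _ _, fun h x y => ?_⟩
  simpa using h (D.next x) (D.next y)

/-- The factor that the smoothed crossings contribute to a term of the skein sum. -/
noncomputable def weight (D : GaussDiagram C) (S : Finset C) : ℤ[X] :=
  Polynomial.C (∏ c ∈ S, (D.sign c : ℤ)) * X ^ S.card

/-- The set of smoothed crossings `S`, with the crossing `p` added if `d = true`. -/
def withCrossing (p : C) (S : Finset C) (d : Bool) : Finset C := if d then insert p S else S

theorem mem_withCrossing_self {p : C} {S : Finset C} (hp : p ∉ S) (d : Bool) :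
    p ∈ withCrossing p S d ↔ d = true := by
  cases d <;> simp [withCrossing, hp]

theorem mem_withCrossing_of_ne {p c : C} {S : Finset C} (hc : c ≠ p) (d : Bool) :
    c ∈ withCrossing p S d ↔ c ∈ S := by
  cases d <;> simp [withCrossing, hc]

theorem arrive_withCrossing_self (D : GaussDiagram C) {p : C} {S : Finset C} (hp : p ∉ S)
    (d s : Bool) : D.arrive (withCrossing p S d) (p, s) = D.next (p, s ^^ d) := by
  cases d <;> simp [arrive_apply, toggle_apply, mem_withCrossing_self hp]

/-- The condition for a term of the skein sum, as far as it does not concern the crossing `p`: with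
`S` and, if `d = true`, also `p` smoothed, there is one component, and starting with the arrival at
`a` one meets the crossings in `S` first on their overpasses. -/
def Counts (D : GaussDiagram C) (p : C) (S : Finset C) (d : Bool) (a : Passage C) : Prop :=
  D.OneComponent (withCrossing p S d) ∧
    ∀ c ∈ S, Before (D.arrive (withCrossing p S d)) (c, true) (c, false) a

open Classical in
theorem skeinSum_empty [Fintype C] (D : GaussDiagram C) (b : Passage C) :
    D.skeinSum ∅ b =
      ∑ S : Finset C, if D.OneComponent S ∧ D.OverFirst S S b then D.weight S else 0 := by
  simp [skeinSum, Finset.sum_filter, weight]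

open Classical in
/-- The terms of the skein sum, by the smoothed crossings apart from `p`. -/
theorem skeinSum_eq_sum_counts [Fintype C] (D : GaussDiagram C) (p : C) (b : Passage C) :
    D.skeinSum ∅ b = ∑ S ∈ (Finset.univ.erase p).powerset, D.weight S *
      ∑ d : Bool, if D.Counts p S d (D.next b) then
        if d then if Before (D.arrive (withCrossing p S d)) (p, true) (p, false) (D.next b) then
          Polynomial.C (D.sign p : ℤ) * X else 0 else 1 else 0 := by
  have hu : (Finset.univ : Finset (Finset C)) = (insert p (Finset.univ.erase p)).powerset := by
    rw [Finset.insert_erase (Finset.mem_univ p), Finset.powerset_univ]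
  rw [skeinSum_empty, hu, Finset.sum_powerset_insert (Finset.notMem_erase _ _),
    ← Finset.sum_add_distrib]
  refine Finset.sum_congr rfl fun S hS => ?_
  have hp : p ∉ S := fun h => Finset.notMem_erase p _ (Finset.mem_powerset.1 hS h)
  have hw : D.weight (insert p S) = D.weight S * (Polynomial.C (D.sign p : ℤ) * X) := by
    simp only [weight, Finset.prod_insert hp, Finset.card_insert_of_notMem hp, Polynomial.C_mul]
    ring
  rw [Fintype.sum_bool, mul_add, add_comm]
  congr 1
  · simp only [hw, Counts, withCrossing, OverFirst, first_iff_before, Finset.forall_mem_insert,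
      Bool.not_true, if_true]
    by_cases h1 : D.OneComponent (insert p S)
    · by_cases h2 : Before (D.arrive (insert p S)) (p, true) (p, false) (D.next b) <;>
        simp [h1, h2]
    · simp [h1]
  · simp [Counts, withCrossing, OverFirst, first_iff_before]

/-! ### Smoothing states of the lassoed diagram -/

/-- A crossing of the tangle as a crossing of the lassoed diagram. -/
def tangleCrossing (p : C) : TangleCrossing ↪ C ⊕ Bool × Bool where
  toFun c := c.elim (Sum.inl p) Sum.inr
  inj' := by rintro (_ | a) (_ | b) <;> simp

@[simp] theorem tangleCrossing_none (p : C) : tangleCrossing p none = Sum.inl p := rfl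

@[simp] theorem tangleCrossing_some (p : C) (a : Bool × Bool) :
    tangleCrossing p (some a) = Sum.inr a := rfl

/-- A passage of the tangle as a passage of the lassoed diagram. -/
def tanglePassage (p : C) (x : Passage TangleCrossing) : Passage (C ⊕ Bool × Bool) :=
  (tangleCrossing p x.1, x.2)

/-- The set of smoothed crossings that consists of `S` outside of the tangle, and `R` inside. -/
def lassoState (p : C) (S : Finset C) (R : Finset TangleCrossing) : Finset (C ⊕ Bool × Bool) :=
  S.map Function.Embedding.inl ∪ R.map (tangleCrossing p)

theorem tanglePassage_injective (p : C) : Function.Injective (tanglePassage p) := by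
  rintro ⟨c, l⟩ ⟨d, m⟩ h
  simpa [tanglePassage, Prod.ext_iff] using h

theorem lassoEnter_injective (p : C) : Function.Injective (lassoEnter p) := by
  rintro ⟨c, l⟩ ⟨d, m⟩ h
  by_cases hc : c = p <;> by_cases hd : d = p <;> simp_all [lassoEnter]

theorem lassoEnter_self (p : C) (s : Bool) :
    lassoEnter p (p, s) = tanglePassage p (tangleEntry s) := by
  simp [lassoEnter, tanglePassage, tangleEntry]

theorem lassoEnter_of_ne {p c : C} (hc : c ≠ p) (l : Bool) :
    lassoEnter p (c, l) = (Sum.inl c, l) := by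
  simp [lassoEnter, hc]

theorem lassoEnter_ne_tanglePassage {p : C} {y : Passage C} (hy : y.1 ≠ p)
    (x : Passage TangleCrossing) : lassoEnter p y ≠ tanglePassage p x := by
  obtain ⟨_ | a, l⟩ := x <;> simp [lassoEnter, hy, tanglePassage, Prod.ext_iff]

theorem lassoEnter_or_tanglePassage (p : C) (x' : Passage (C ⊕ Bool × Bool)) :
    (∃ y : Passage C, y.1 ≠ p ∧ x' = lassoEnter p y) ∨ ∃ x, x' = tanglePassage p x := by
  obtain ⟨c | a, l⟩ := x'
  · by_cases h : c = p
    · exact Or.inr ⟨(none, l), by simp [tanglePassage, h]⟩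
    · exact Or.inl ⟨(c, l), h, by simp [lassoEnter, h]⟩
  · exact Or.inr ⟨(some a, l), by simp [tanglePassage]⟩

theorem inl_mem_lassoState {p c : C} (hc : c ≠ p) (S : Finset C) (R : Finset TangleCrossing) :
    Sum.inl c ∈ lassoState p S R ↔ c ∈ S := by
  simp [lassoState, Option.exists, hc.symm]

theorem tangleCrossing_mem_lassoState {p : C} {S : Finset C} (hp : p ∉ S)
    (R : Finset TangleCrossing) (c : TangleCrossing) :
    tangleCrossing p c ∈ lassoState p S R ↔ c ∈ R := by
  rw [lassoState, Finset.mem_union, Finset.mem_map' (tangleCrossing p), or_iff_right]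
  obtain _ | a := c <;> simp [hp]

theorem forall_mem_lassoState {p : C} {S : Finset C} {R : Finset TangleCrossing}
    {P : C ⊕ Bool × Bool → Prop} :
    (∀ c ∈ lassoState p S R, P c) ↔
      (∀ c ∈ S, P (Sum.inl c)) ∧ ∀ c ∈ R, P (tangleCrossing p c) := by
  simp only [lassoState, Finset.mem_union, or_imp, forall_and, Finset.forall_mem_map]
  rfl

theorem sum_lassoState [Fintype C] {M : Type*} [AddCommMonoid M] (p : C)
    (f : Finset (C ⊕ Bool × Bool) → M) :
    ∑ S, f S = ∑ S ∈ (Finset.univ.erase p).powerset, ∑ R, f (lassoState p S R) := by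
  have hne : ∀ S ∈ (Finset.univ.erase p).powerset, p ∉ S :=
    fun S hS h => Finset.notMem_erase p _ (Finset.mem_powerset.1 hS h)
  rw [← Finset.sum_product']
  symm
  refine Finset.sum_bij' (fun SR _ => lassoState p SR.1 SR.2)
    (fun S _ => (Finset.univ.filter fun c => c ≠ p ∧ Sum.inl c ∈ S,
      Finset.univ.filter fun c => tangleCrossing p c ∈ S)) (by simp) ?_ ?_ ?_
    (by simp)
  · intro S _
    simp only [Finset.mem_product, Finset.mem_powerset, Finset.mem_univ, and_true]
    intro c hc
    simp only [Finset.mem_filter] at hc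
    simp [hc.2.1]
  · rintro ⟨S, R⟩ h
    have hp := hne S (Finset.mem_product.1 h).1
    ext c
    · simp only [Finset.mem_filter, Finset.mem_univ, true_and]
      by_cases hc : c = p
      · simp [hc, hp]
      · simp [hc, inl_mem_lassoState hc]
    · simp [tangleCrossing_mem_lassoState hp]
  · intro S _
    ext x
    obtain c | a := x
    · by_cases hc : c = p
      · subst hc
        exact (tangleCrossing_mem_lassoState (by simp) _ none).trans (by simp)
      · simp [inl_mem_lassoState hc, hc]
    · exact (tangleCrossing_mem_lassoState (by simp) _ (some a)).trans (by simp)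

theorem weight_lassoState (D : GaussDiagram C) {p : C} {S : Finset C} (hp : p ∉ S) (ccw : Bool)
    (R : Finset TangleCrossing) : (D.lasso p ccw).weight (lassoState p S R) =
      D.weight S * tangleWeight (decide (D.sign p = 1)) ccw R := by
  have hd : Disjoint (S.map Function.Embedding.inl) (R.map (tangleCrossing p)) := by
    rw [Finset.disjoint_left]
    simp only [Finset.mem_map]
    rintro _ ⟨c, hc, rfl⟩ ⟨_ | a, _, h⟩
    · have : p = c := by simpa using h
      exact hp (this ▸ hc)
    · simp at h
  have h1 : ∏ c ∈ S, ((D.lasso p ccw).sign (Sum.inl c) : ℤ) = ∏ c ∈ S, (D.sign c : ℤ) := by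
    refine Finset.prod_congr rfl fun c hc => ?_
    have : c ≠ p := by rintro rfl; exact hp hc
    simp [lasso, this]
  have h2 : ∀ c, ((D.lasso p ccw).sign (tangleCrossing p c) : ℤ) =
      tangleSign (decide (D.sign p = 1)) ccw c := by
    rintro (_ | a)
    · rcases Int.units_eq_one_or (D.sign p) with h | h <;>
        simp [lasso, tangleSign, boolSign, h]
    · by_cases h : (a.1 == a.2) = ccw <;>
        simp [lasso, tangleSign, boolSign, h]
  simp only [weight, tangleWeight, lassoState]
  rw [Finset.card_union_of_disjoint hd, Finset.prod_union hd, Finset.card_map, Finset.card_map,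
    Finset.prod_map, Finset.prod_map]
  simp only [Function.Embedding.inl_apply, h1, h2, Polynomial.C_mul]
  ring

/-! ### Walking through the lassoed diagram -/

theorem arrive_lasso_tanglePassage (D : GaussDiagram C) {p : C} {S : Finset C} (hp : p ∉ S)
    (ccw : Bool) (R : Finset TangleCrossing) (x : Passage TangleCrossing) :
    (D.lasso p ccw).arrive (lassoState p S R) (tanglePassage p x) =
      Sum.elim (tanglePassage p) (fun f => lassoEnter p (D.next (p, f)))
        (tangleStep (decide (D.sign p = 1) == ccw) R x) := by
  have h : toggle (lassoState p S R) (tanglePassage p x) = tanglePassage p (toggle R x) := by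
    obtain ⟨c, l⟩ := x
    by_cases hc : c ∈ R <;>
      simp [tanglePassage, toggle_apply, tangleCrossing_mem_lassoState hp, hc]
  rw [arrive_apply, h, tangleStep, lasso_next]
  generalize toggle R x = y
  obtain ⟨_ | ⟨s, e⟩, l⟩ := y
  · simp [tanglePassage, lassoNext]
  · by_cases hl : l = s <;> cases e <;> simp [tanglePassage, lassoNext, hl]

theorem isPath_tangleWalk (D : GaussDiagram C) {p : C} {S : Finset C} (hp : p ∉ S)
    (ccw : Bool) (R : Finset TangleCrossing) {f : Bool} (n : ℕ) (x : Passage TangleCrossing)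
    (h : (tangleWalk (decide (D.sign p = 1) == ccw) R n x).2 = some f) :
    IsPath ((D.lasso p ccw).arrive (lassoState p S R)) (tanglePassage p x)
      ((tangleWalk (decide (D.sign p = 1) == ccw) R n x).1.map (tanglePassage p))
      (lassoEnter p (D.next (p, f))) := by
  induction n generalizing x with
  | zero => simp [tangleWalk] at h
  | succ n ih =>
    have hx := D.arrive_lasso_tanglePassage hp ccw R x
    rw [tangleWalk] at h ⊢
    cases hs : tangleStep (decide (D.sign p = 1) == ccw) R x with
    | inl y =>
      rw [hs] at hx
      simp only [hs] at h ⊢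
      exact ⟨rfl, hx ▸ ih y h⟩
    | inr f' =>
      rw [hs] at hx
      simp only [hs] at h ⊢
      obtain rfl : f' = f := by simpa using h
      exact ⟨rfl, hx⟩

/-- The passages in the tangle that are inserted, after the first one, where `D` passes `x`. -/
def lassoInsertion (p : C) (cyc : Bool) (R : Finset TangleCrossing) (x : Passage C) :
    List (Passage (C ⊕ Bool × Bool)) :=
  if x.1 = p then (tanglePath cyc R (tangleEntry x.2)).1.tail.map (tanglePassage p) else []

theorem lassoEnter_notMem_lassoInsertion (p : C) (cyc : Bool) (R : Finset TangleCrossing)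
    (x y : Passage C) : lassoEnter p y ∉ lassoInsertion p cyc R x := by
  by_cases hx : x.1 = p
  · simp only [lassoInsertion, hx, if_true, List.mem_map, not_exists, not_and]
    intro z hz h
    by_cases hy : y.1 = p
    · obtain ⟨c, l⟩ := y
      obtain rfl : c = p := hy
      rw [lassoEnter_self] at h
      rw [tanglePassage_injective _ h] at hz
      exact tangleEntry_notMem_tail _ _ _ _ hz
    · exact lassoEnter_ne_tanglePassage hy _ h.symm
  · simp [lassoInsertion, hx]

/-- The lassoed diagram, with `S` smoothed outside and `R` inside of the tangle, runs through the
passages of `D` in the same order as `D` itself with `S` and possibly `p` smoothed, and through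
passages of the tangle in between. -/
theorem isPath_lassoInsertion (D : GaussDiagram C) {p : C} {S : Finset C} (hp : p ∉ S) (ccw : Bool)
    (R : Finset TangleCrossing) {cyc : Bool} (hcyc : (decide (D.sign p = 1) == ccw) = cyc)
    (x : Passage C) :
    IsPath ((D.lasso p ccw).arrive (lassoState p S R)) (lassoEnter p x)
      (lassoEnter p x :: lassoInsertion p cyc R x)
      (lassoEnter p (D.arrive (withCrossing p S (tangleCrossed cyc R)) x)) := by
  subst hcyc
  obtain ⟨c, l⟩ := x
  by_cases hc : c = p
  · subst hc
    rw [arrive_withCrossing_self _ hp, lassoEnter_self]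
    have := D.isPath_tangleWalk hp ccw R 10 (tangleEntry l) (tanglePath_entry_snd _ _ _)
    rw [tanglePath_entry_fst] at this
    simpa [lassoInsertion] using this
  · simp only [lassoInsertion, hc, if_false]
    refine ⟨rfl, ?_⟩
    have h : toggle (lassoState p S R) (lassoEnter p (c, l)) =
        lassoLeave p (toggle (withCrossing p S (tangleCrossed
          (decide (D.sign p = 1) == ccw) R)) (c, l)) := by
      by_cases h : c ∈ S <;> simp [lassoEnter_of_ne hc, toggle_apply, inl_mem_lassoState hc,
        mem_withCrossing_of_ne hc, h, lassoLeave, hc]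
    rw [arrive_apply, arrive_apply, h, lasso_next, lassoNext_lassoLeave]
    rfl

theorem oneComponent_lasso_iff [Finite C] (D : GaussDiagram C) {p : C} {S : Finset C} (hp : p ∉ S)
    (ccw : Bool) (R : Finset TangleCrossing) {cyc : Bool}
    (hcyc : (decide (D.sign p = 1) == ccw) = cyc) :
    (D.lasso p ccw).OneComponent (lassoState p S R) ↔
      D.OneComponent (withCrossing p S (tangleCrossed cyc R)) ∧ TangleFull cyc R := by
  have : Nonempty (Passage C) := ⟨(p, true)⟩
  rw [oneComponent_iff_arrive, oneComponent_iff_arrive,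
    sameCycle_insertion_iff (lassoEnter_injective p) (D.isPath_lassoInsertion hp ccw R hcyc)
      (lassoEnter_notMem_lassoInsertion p cyc R), and_assoc]
  refine and_congr Iff.rfl (and_congr Iff.rfl ?_)
  have hl : ∀ s, lassoEnter p (p, s) :: lassoInsertion p cyc R (p, s) =
      (tanglePath cyc R (tangleEntry s)).1.map (tanglePassage p) := by
    intro s
    rw [tanglePath_entry_fst, List.map_cons, lassoEnter_self]
    simp [lassoInsertion]
  constructor
  · intro h x
    obtain ⟨⟨c, s⟩, hs⟩ := h (tanglePassage p x)
    by_cases hc : c = p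
    · rw [hc, hl, List.mem_map_of_injective (tanglePassage_injective p)] at hs
      exact ⟨s, hs⟩
    · simp only [lassoInsertion, hc, if_false, List.mem_singleton] at hs
      exact absurd hs.symm (lassoEnter_ne_tanglePassage hc x)
  · intro h b
    rcases lassoEnter_or_tanglePassage p b with ⟨y, -, rfl⟩ | ⟨x, rfl⟩
    · exact ⟨y, by simp⟩
    · obtain ⟨s, hs⟩ := h x
      refine ⟨(p, s), ?_⟩
      rw [hl]
      exact List.mem_map_of_mem hs

/-! ### The order in which the crossings are met -/

/-- If a walk runs through the list `l` of passages of the tangle, and afterwards meets `c` as the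
list `L` says, then it meets `c` as `l ++ L` says. -/
theorem before_of_find_append {p : C} {g : Equiv.Perm (Passage (C ⊕ Bool × Bool))}
    {y : Passage (C ⊕ Bool × Bool)} (c : TangleCrossing) {L : List (Passage TangleCrossing)}
    (hL : ∀ m, L.find? (fun z => z.1 = c) = some (c, m) →
      (Before g (tanglePassage p (c, true)) (tanglePassage p (c, false)) y ↔ m = true))
    {l : List (Passage TangleCrossing)} {x : Passage (C ⊕ Bool × Bool)}
    (hl : IsPath g x (l.map (tanglePassage p)) y) (m : Bool)
    (hm : (l ++ L).find? (fun z => z.1 = c) = some (c, m)) :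
    Before g (tanglePassage p (c, true)) (tanglePassage p (c, false)) x ↔ m = true := by
  have hinj := tanglePassage_injective p
  induction l generalizing x with
  | nil =>
    obtain rfl : x = y := hl
    exact hL m hm
  | cons z l ih =>
    obtain ⟨rfl, hl⟩ := hl
    by_cases hz : z.1 = c
    · obtain rfl : z = (c, m) := by simpa [hz] using hm
      cases m
      · simpa using not_before_self
      · simpa using before_self (hinj.ne (by simp))
    · have hne : ∀ t, tanglePassage p z ≠ tanglePassage p (c, t) := fun t h => hz (by rw [hinj h])
      rw [before_iff_apply (hne _) (hne _)]
      exact ih hl (by simpa [hz] using hm)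

theorem isPath_tanglePath_entry (D : GaussDiagram C) {p : C} {S : Finset C} (hp : p ∉ S)
    (ccw : Bool) (R : Finset TangleCrossing) {cyc : Bool}
    (hcyc : (decide (D.sign p = 1) == ccw) = cyc) (s : Bool) :
    IsPath ((D.lasso p ccw).arrive (lassoState p S R)) (lassoEnter p (p, s))
      ((tanglePath cyc R (tangleEntry s)).1.map (tanglePassage p))
      (lassoEnter p (D.arrive (withCrossing p S (tangleCrossed cyc R)) (p, s))) := by
  subst hcyc
  rw [lassoEnter_self, arrive_withCrossing_self _ hp]
  exact D.isPath_tangleWalk hp ccw R 10 _ (tanglePath_entry_snd _ _ _)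

/-- Until the tangle is entered for the first time, no crossing of the tangle is met. -/
theorem before_lasso_iff_of_before (D : GaussDiagram C) {p : C} {S : Finset C} (hp : p ∉ S)
    (ccw : Bool) (R : Finset TangleCrossing) {cyc : Bool}
    (hcyc : (decide (D.sign p = 1) == ccw) = cyc) {e : Bool} {a : Passage C}
    (ha : Before (D.arrive (withCrossing p S (tangleCrossed cyc R))) (p, e) (p, !e) a)
    (x y : Passage TangleCrossing) :
    Before ((D.lasso p ccw).arrive (lassoState p S R)) (tanglePassage p x) (tanglePassage p y)
        (lassoEnter p a) ↔
      Before ((D.lasso p ccw).arrive (lassoState p S R)) (tanglePassage p x) (tanglePassage p y)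
        (lassoEnter p (p, e)) := by
  obtain ⟨k, hk, hk'⟩ := ha
  induction k generalizing a with
  | zero =>
    obtain rfl : a = (p, e) := hk
    rfl
  | succ k ih =>
    by_cases hae : a = (p, e)
    · rw [hae]
    have hap : a.1 ≠ p := by
      intro h
      have h0 : a ≠ (p, !e) := hk' 0 (Nat.zero_le _)
      obtain ⟨c, l⟩ := a
      obtain rfl : c = p := h
      cases l <;> cases e <;> simp_all
    have hpath := D.isPath_lassoInsertion hp ccw R hcyc a
    rw [lassoInsertion, if_neg hap] at hpath
    rw [hpath.before_iff (by simpa using (lassoEnter_ne_tanglePassage hap x).symm)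
      (by simpa using (lassoEnter_ne_tanglePassage hap y).symm)]
    refine ih ?_ fun j hj => ?_
    · rw [← hk, pow_succ, Equiv.Perm.mul_apply]
    · rw [← Equiv.Perm.mul_apply, ← pow_succ]
      exact hk' (j + 1) (by omega)

/-- The order in which the passages of a crossing of the tangle are met: after the list `J`, one
enters the tangle on the branch `e`, and later on the other one. -/
theorem before_lasso_of_find [Finite C] (D : GaussDiagram C) {p : C} {S : Finset C} (hp : p ∉ S)
    (ccw : Bool) (R : Finset TangleCrossing) {cyc : Bool}
    (hcyc : (decide (D.sign p = 1) == ccw) = cyc)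
    (hD : D.OneComponent (withCrossing p S (tangleCrossed cyc R))) {e : Bool} {a : Passage C}
    (ha : Before (D.arrive (withCrossing p S (tangleCrossed cyc R))) (p, e) (p, !e) a)
    {J : List (Passage TangleCrossing)} {x : Passage (C ⊕ Bool × Bool)}
    (hJ : IsPath ((D.lasso p ccw).arrive (lassoState p S R)) x (J.map (tanglePassage p))
      (lassoEnter p a)) (c : TangleCrossing) (m : Bool)
    (hm : (J ++ tangleRound cyc R e).find? (fun z => z.1 = c) = some (c, m)) :
    Before ((D.lasso p ccw).arrive (lassoState p S R)) (tanglePassage p (c, true))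
      (tanglePassage p (c, false)) x ↔ m = true := by
  have hg := ((oneComponent_iff_arrive _ _).1 hD).2
  have hpath := D.isPath_tanglePath_entry hp ccw R hcyc
  have hback := before_apply hg (x := (p, !e)) (y := (p, e)) (by simp)
  -- Back outside after the first passage through the tangle, one comes next to the other branch.
  have hback' : Before (D.arrive (withCrossing p S (tangleCrossed cyc R))) (p, !e) (p, !!e)
      (D.arrive (withCrossing p S (tangleCrossed cyc R)) (p, e)) := by simpa using hback
  refine before_of_find_append c (fun m hm => ?_) hJ m hm
  rw [D.before_lasso_iff_of_before hp ccw R hcyc ha]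
  refine before_of_find_append c (fun m hm => ?_) (hpath e) m hm
  rw [D.before_lasso_iff_of_before hp ccw R hcyc hback']
  exact before_of_find_append (L := []) c (by simp) (hpath !e) m (by simpa using hm)

/-- The terms of the skein sum of the lassoed diagram that count. The list `J` contains the passages
that are met inside of the tangle before one leaves it for the first time, to arrive outside
at `a`. -/
theorem lasso_counts_iff [Finite C] (D : GaussDiagram C) {p : C} {S : Finset C} (hp : p ∉ S)
    (ccw : Bool) (R : Finset TangleCrossing) {cyc : Bool}
    (hcyc : (decide (D.sign p = 1) == ccw) = cyc) {e : Bool} {a : Passage C}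
    (ha : D.OneComponent (withCrossing p S (tangleCrossed cyc R)) →
      Before (D.arrive (withCrossing p S (tangleCrossed cyc R))) (p, e) (p, !e) a)
    {J : List (Passage TangleCrossing)} {b : Passage (C ⊕ Bool × Bool)}
    (hJ : IsPath ((D.lasso p ccw).arrive (lassoState p S R)) ((D.lasso p ccw).next b)
      (J.map (tanglePassage p)) (lassoEnter p a)) :
    (D.lasso p ccw).OneComponent (lassoState p S R) ∧
        (D.lasso p ccw).OverFirst (lassoState p S R) (lassoState p S R) b ↔
      TangleFull cyc R ∧ D.Counts p S (tangleCrossed cyc R) a ∧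
        ListOverFirst R (J ++ tangleRound cyc R e) := by
  rw [D.oneComponent_lasso_iff hp ccw R hcyc, Counts]
  by_cases hD : D.OneComponent (withCrossing p S (tangleCrossed cyc R)); swap
  · simp [hD]
  by_cases hR : TangleFull cyc R; swap
  · simp [hR]
  simp only [hD, hR, true_and, OverFirst, forall_mem_lassoState, first_iff_before, Bool.not_true]
  refine and_congr (forall₂_congr fun c hc => ?_) (forall₂_congr fun c _ => ?_)
  · have hcp : c ≠ p := by rintro rfl; exact hp hc
    have hnot : ∀ l, lassoEnter p (c, l) ∉ J.map (tanglePassage p) := by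
      intro l h
      obtain ⟨z, -, hz⟩ := List.mem_map.1 h
      exact lassoEnter_ne_tanglePassage hcp z hz.symm
    rw [← lassoEnter_of_ne hcp, ← lassoEnter_of_ne hcp, hJ.before_iff (hnot _) (hnot _)]
    exact before_insertion_iff (lassoEnter_injective p) (D.isPath_lassoInsertion hp ccw R hcyc)
      (lassoEnter_notMem_lassoInsertion p cyc R) ((oneComponent_iff_arrive _ _).1 hD).2 (by simp)
  · obtain ⟨m, hm⟩ : ∃ m, (J ++ tangleRound cyc R e).find? (fun z => z.1 = c) = some (c, m) := by
      rw [List.find?_append]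
      cases hz : J.find? (fun z => z.1 = c) with
      | none => simpa using hR.exists_find e c
      | some z =>
        have : z.1 = c := by simpa using List.find?_some hz
        exact ⟨z.2, by simp [← this]⟩
    rw [hm]
    refine (D.before_lasso_of_find hp ccw R hcyc hD (ha hD) hJ c m hm).trans ?_
    simp

/-! ### The skein sums of the lassoed diagram -/

theorem sign_eq_boolSign (D : GaussDiagram C) (p : C) :
    (D.sign p : ℤ) = boolSign (decide (D.sign p = 1)) := by
  rcases Int.units_eq_one_or (D.sign p) with h | h <;> simp [boolSign, h]

variable [Fintype C]

/-- The effect of lassoing on the skein sum for a base edge that leads, outside of the lasso, to a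
passage of `D`. -/
theorem skeinSum_lasso_of_next_eq (D : GaussDiagram C) (p : C) (ccw : Bool) {b : Passage C}
    {b' : Passage (C ⊕ Bool × Bool)} (hb : (D.lasso p ccw).next b' = lassoEnter p (D.next b)) :
    (D.lasso p ccw).skeinSum ∅ b' =
      Polynomial.C (D.sign p : ℤ) * X ^ 3 * D.skeinSum ∅ b := by
  classical
  rw [skeinSum_empty, sum_lassoState p, D.skeinSum_eq_sum_counts p, Finset.mul_sum]
  refine Finset.sum_congr rfl fun S hS => ?_
  have hp : p ∉ S := fun h => Finset.notMem_erase p _ (Finset.mem_powerset.1 hS h)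
  obtain ⟨cyc, hcyc⟩ : ∃ cyc, (decide (D.sign p = 1) == ccw) = cyc := ⟨_, rfl⟩
  obtain ⟨e, he⟩ : ∃ e : Bool → Bool, ∀ d, e d = decide
      (Before (D.arrive (withCrossing p S d)) (p, true) (p, false) (D.next b)) := ⟨_, fun _ => rfl⟩
  have hterm : ∀ R, (if (D.lasso p ccw).OneComponent (lassoState p S R) ∧
      (D.lasso p ccw).OverFirst (lassoState p S R) (lassoState p S R) b' then
        (D.lasso p ccw).weight (lassoState p S R) else 0) =
      D.weight S * ∑ d : Bool, if D.Counts p S d (D.next b) then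
        if Through cyc d (e d) R then tangleWeight (decide (D.sign p = 1)) ccw R else 0
        else 0 := by
    intro R
    have ha : D.OneComponent (withCrossing p S (tangleCrossed cyc R)) →
        Before (D.arrive (withCrossing p S (tangleCrossed cyc R))) (p, e (tangleCrossed cyc R))
          (p, !e (tangleCrossed cyc R)) (D.next b) := by
      intro hD
      have hg := ((oneComponent_iff_arrive _ _).1 hD).2
      cases h : e (tangleCrossed cyc R)
      · refine (before_swap_iff hg (by simp) _).2 ?_
        simpa [he] using h
      · simpa [he] using h
    simp only [D.lasso_counts_iff hp ccw R hcyc ha (J := []) hb, D.weight_lassoState hp]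
    rw [Finset.sum_eq_single (tangleCrossed cyc R)]
    · by_cases h1 : D.Counts p S (tangleCrossed cyc R) (D.next b) <;>
        by_cases h2 : TangleFull cyc R <;> simp [Through, h1, h2]
    · intro d _ hd
      simp [Through, hd.symm]
    · simp
  rw [Finset.sum_congr rfl fun R _ => hterm R, ← Finset.mul_sum, Finset.sum_comm, mul_left_comm]
  congr 1
  rw [Finset.mul_sum]
  refine Finset.sum_congr rfl fun d _ => ?_
  by_cases h : D.Counts p S d (D.next b); swap
  · simp [h]
  have hsum := tangleSum_through (decide (D.sign p = 1)) ccw d (e d)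
  rw [hcyc, tangleSum, Finset.sum_filter, ← sign_eq_boolSign] at hsum
  simp only [h, if_true]
  rw [hsum, he]
  simp

open Classical in
/-- The sum of the weights of the states outside of `p` that count if one starts by leaving `p`
along the branch `f`, where `d` tells whether the branches of `p` are smoothed. -/
noncomputable def outerSum (D : GaussDiagram C) (p : C) (d f : Bool) : ℤ[X] :=
  ∑ S ∈ (Finset.univ.erase p).powerset, if D.Counts p S d (D.next (p, f)) then D.weight S else 0

/-- The skein sum of the lassoed diagram for a base edge in the tangle. -/
theorem skeinSum_lasso_of_next_tanglePassage (D : GaussDiagram C) (p : C) (ccw : Bool)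
    {x : Passage TangleCrossing} {b : Passage (C ⊕ Bool × Bool)}
    (hb : (D.lasso p ccw).next b = tanglePassage p x) :
    (D.lasso p ccw).skeinSum ∅ b = ∑ d : Bool, ∑ f : Bool, D.outerSum p d f *
      tangleSum (decide (D.sign p = 1)) ccw
        (FromInside (decide (D.sign p = 1) == ccw) d f x) := by
  classical
  obtain ⟨cyc, hcyc⟩ : ∃ cyc, (decide (D.sign p = 1) == ccw) = cyc := ⟨_, rfl⟩
  have hterm : ∀ S ∈ (Finset.univ.erase p).powerset, ∀ R,
      (if (D.lasso p ccw).OneComponent (lassoState p S R) ∧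
      (D.lasso p ccw).OverFirst (lassoState p S R) (lassoState p S R) b then
        (D.lasso p ccw).weight (lassoState p S R) else 0) =
      ∑ d : Bool, ∑ f : Bool,
        (if D.Counts p S d (D.next (p, f)) then D.weight S else 0) *
        if FromInside cyc d f x R then tangleWeight (decide (D.sign p = 1)) ccw R else 0 := by
    intro S hS R
    have hp : p ∉ S := fun h => Finset.notMem_erase p _ (Finset.mem_powerset.1 hS h)
    by_cases hR : TangleFull cyc R; swap
    · simp [D.oneComponent_lasso_iff hp ccw R hcyc, hR, FromInside]
    obtain ⟨f, hf⟩ := hR.exists_exit x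
    have ha : D.OneComponent (withCrossing p S (tangleCrossed cyc R)) →
        Before (D.arrive (withCrossing p S (tangleCrossed cyc R)))
          (p, !(f ^^ tangleCrossed cyc R)) (p, !!(f ^^ tangleCrossed cyc R)) (D.next (p, f)) := by
      intro hD
      have h := before_apply ((oneComponent_iff_arrive _ _).1 hD).2
        (x := (p, !(f ^^ tangleCrossed cyc R))) (y := (p, f ^^ tangleCrossed cyc R)) (by simp)
      rw [arrive_withCrossing_self _ hp] at h
      simpa using h
    have hJ := D.isPath_tangleWalk hp ccw R 10 x (by rw [hcyc]; exact hf)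
    rw [← hb, hcyc] at hJ
    simp only [D.lasso_counts_iff hp ccw R hcyc ha hJ, D.weight_lassoState hp]
    rw [Finset.sum_eq_single (tangleCrossed cyc R), Finset.sum_eq_single f]
    · by_cases h1 : D.Counts p S (tangleCrossed cyc R) (D.next (p, f)) <;>
        simp [FromInside, h1, hR, hf]
    · intro f' _ hf'
      simp [FromInside, hf, hf'.symm]
    · simp
    · intro d _ hd
      simp [FromInside, hd.symm]
    · simp
  rw [skeinSum_empty, sum_lassoState p,
    Finset.sum_congr rfl fun S hS => Finset.sum_congr rfl fun R _ => hterm S hS R, hcyc]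
  simp only [outerSum, tangleSum, Finset.sum_filter, Finset.sum_mul_sum, Fintype.sum_bool,
    Finset.sum_add_distrib]

/-! ### Skein sums of the given diagram for base edges at the crossing -/

/-- A skein sum of `D` in terms of `outerSum`, if the states that count are those for leaving `p`
along `f₀` or `f₁`, and `s` tells whether `p`, if smoothed, is met first on its overpass. -/
theorem skeinSum_of_counts_iff (D : GaussDiagram C) (p : C) {b : Passage C} {s f₀ f₁ : Bool}
    (h₀ : ∀ S, p ∉ S → (D.Counts p S false (D.next b) ↔ D.Counts p S false (D.next (p, f₀))))
    (h₁ : ∀ S, p ∉ S → (D.Counts p S true (D.next b) ↔ D.Counts p S true (D.next (p, f₁))))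
    (hs : ∀ S, p ∉ S → D.Counts p S true (D.next b) →
      (Before (D.arrive (withCrossing p S true)) (p, true) (p, false) (D.next b) ↔ s = true)) :
    D.skeinSum ∅ b = D.outerSum p false f₀ +
      if s then Polynomial.C (D.sign p : ℤ) * X * D.outerSum p true f₁ else 0 := by
  classical
  have hS : ∀ S ∈ (Finset.univ.erase p).powerset, p ∉ S :=
    fun S hS h => Finset.notMem_erase p _ (Finset.mem_powerset.1 hS h)
  simp only [D.skeinSum_eq_sum_counts p, outerSum, Finset.mul_sum, Fintype.sum_bool]
  cases s
  · simp only [Bool.false_eq_true, if_false, add_zero, iff_false] at hs ⊢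
    refine Finset.sum_congr rfl fun S hS' => ?_
    by_cases h : D.Counts p S true (D.next b)
    · simp [h, hs S (hS S hS') h, h₀ S (hS S hS')]
    · simp [h, h₀ S (hS S hS')]
  · simp only [if_true, iff_true] at hs ⊢
    rw [← Finset.sum_add_distrib]
    refine Finset.sum_congr rfl fun S hS' => ?_
    rw [mul_add, add_comm]
    congr 1
    · simp [h₀ S (hS S hS')]
    · by_cases h : D.Counts p S true (D.next b)
      · simp [h, hs S (hS S hS') h, (h₁ S (hS S hS')).1 h, mul_comm]
      · simp [h, ← h₁ S (hS S hS')]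

/-- The skein sum for the base edge that leaves `p` along the branch `f`. -/
theorem skeinSum_leaving (D : GaussDiagram C) (p : C) (f : Bool) :
    D.skeinSum ∅ (p, f) = D.outerSum p false f +
      if f then Polynomial.C (D.sign p : ℤ) * X * D.outerSum p true f else 0 := by
  refine D.skeinSum_of_counts_iff p (fun _ _ => Iff.rfl) (fun _ _ => Iff.rfl) fun S hp h => ?_
  have hg := ((oneComponent_iff_arrive _ _).1 h.1).2
  -- With `p` smoothed, one has arrived on the branch `!f`, and arrives next on the branch `f`.
  have key : Before (D.arrive (withCrossing p S true)) (p, f) (p, !f) (D.next (p, f)) := by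
    have := before_apply hg (x := (p, f)) (y := (p, !f)) (by simp)
    rwa [arrive_withCrossing_self _ hp, Bool.xor_true, Bool.not_not] at this
  cases f
  · simpa using key.not_before_swap
  · simpa using key

/-- The skein sum for the base edge that arrives at `p` on the branch `s`. -/
theorem skeinSum_arriving (D : GaussDiagram C) (p : C) (s : Bool) {b : Passage C}
    (hb : D.next b = (p, s)) : D.skeinSum ∅ b = D.outerSum p false s +
      if s then Polynomial.C (D.sign p : ℤ) * X * D.outerSum p true (!s) else 0 := by
  have key : ∀ S, p ∉ S → ∀ d,
      (D.Counts p S d (D.next b) ↔ D.Counts p S d (D.next (p, s ^^ d))) := by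
    intro S hp d
    refine and_congr Iff.rfl (forall₂_congr fun c hc => ?_)
    have hcp : p ≠ c := by rintro rfl; exact hp hc
    rw [hb, before_iff_apply (by simp [hcp]) (by simp [hcp]), arrive_withCrossing_self _ hp]
  refine D.skeinSum_of_counts_iff p (fun S hp => by simpa using key S hp false)
    (fun S hp => by simpa using key S hp true) fun S _ _ => ?_
  rw [hb]
  cases s
  · simpa using not_before_self
  · simpa using before_self (by simp)

/-- The effect of lassoing on the skein sum for a base edge in the tangle, if all base edges of `D`
give the same polynomial. -/
theorem skeinSum_lasso_of_forall_eq (D : GaussDiagram C) (p : C) (ccw : Bool) {P : ℤ[X]}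
    (hP : ∀ b, D.skeinSum ∅ b = P) {x : Passage TangleCrossing} {b : Passage (C ⊕ Bool × Bool)}
    (hb : (D.lasso p ccw).next b = tanglePassage p x) :
    (D.lasso p ccw).skeinSum ∅ b = Polynomial.C (D.sign p : ℤ) * X ^ 3 * P := by
  have h1 := (D.skeinSum_leaving p true).symm.trans (hP _)
  have h2 := (D.skeinSum_leaving p false).symm.trans (hP _)
  have h3 := (D.skeinSum_arriving p true (D.next.apply_symm_apply _)).symm.trans (hP _)
  have t1 := tangleSum_fromInside_uncrossed (decide (D.sign p = 1)) ccw x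
  have t2 := tangleSum_fromInside_crossed (decide (D.sign p = 1)) ccw x
  rw [← sign_eq_boolSign] at t1 t2
  have hs : Polynomial.C (D.sign p : ℤ) * Polynomial.C (D.sign p : ℤ) = 1 := by
    rcases Int.units_eq_one_or (D.sign p) with h | h <;> simp [h]
  have hs0 : Polynomial.C (D.sign p : ℤ) * X ≠ 0 := mul_ne_zero (by simp) X_ne_zero
  simp only [if_true, Bool.false_eq_true, if_false, add_zero, Bool.not_true] at h1 h2 h3
  have hY : D.outerSum p true true = D.outerSum p true false :=
    mul_left_cancel₀ hs0 (by linear_combination h1 - h3)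
  rw [D.skeinSum_lasso_of_next_tanglePassage p ccw hb]
  simp only [Fintype.sum_bool]
  -- The two arcs outside of `p` count alike if `p` is smoothed, so the sum over `f` reduces to the
  -- two identities for the tangle.
  generalize tangleSum _ ccw (FromInside _ false true x) = B₁ at *
  generalize tangleSum _ ccw (FromInside _ false false x) = B₀ at *
  linear_combination (P - Polynomial.C (D.sign p : ℤ) * X * D.outerSum p true true) * t1 +
    D.outerSum p true true * t2 + B₁ * h1 + B₀ * h2 - D.outerSum p true true * X ^ 4 * hs -
    tangleSum (decide (D.sign p = 1)) ccw
      (FromInside (decide (D.sign p = 1) == ccw) true false x) * hY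

end GaussDiagram

theorem LinkDiagram.conway_eq_of_forall_eq {C : Type*} [DecidableEq C] [Fintype C] [Nonempty C]
    (D : LinkDiagram C) {P : ℤ[X]} (hP : ∀ b, D.skeinSum ∅ b = P) : D.conway = P := by
  have h : ∃ P : ℤ[X], ∀ b : Passage C, D.skeinSum ∅ b = P := ⟨P, hP⟩
  rw [conway, if_neg (not_isEmpty_of_nonempty C), dif_pos h]
  obtain ⟨c⟩ := ‹Nonempty C›
  exact (h.choose_spec (c, true)).symm.trans (hP _)

/-- Lassoing multiplies the Conway polynomial by `± z ^ 3`, with the sign of the crossing. -/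
theorem LinkDiagram.conway_lasso {C : Type*} [DecidableEq C] [Fintype C] (D : LinkDiagram C) (p : C)
    (ccw : Bool) :
    (D.lasso p ccw).conway = Polynomial.C (D.sign p : ℤ) * X ^ 3 * D.conway := by
  have : Nonempty C := ⟨p⟩
  have hs0 : Polynomial.C (D.sign p : ℤ) * X ^ 3 ≠ 0 :=
    mul_ne_zero (by simp) (pow_ne_zero _ X_ne_zero)
  by_cases h : ∃ P : ℤ[X], ∀ b, D.skeinSum ∅ b = P
  · obtain ⟨P, hP⟩ := h
    rw [D.conway_eq_of_forall_eq hP]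
    refine conway_eq_of_forall_eq _ fun b => ?_
    rcases GaussDiagram.lassoEnter_or_tanglePassage p ((D.lasso p ccw).next b) with
      ⟨y, -, hy⟩ | ⟨x, hx⟩
    · rw [← hP (D.next.symm y)]
      exact D.skeinSum_lasso_of_next_eq p ccw 
        (hy.trans (congrArg _ (D.next.apply_symm_apply y).symm))
    · exact D.skeinSum_lasso_of_forall_eq p ccw hP hx
  -- The base edges outside of the lasso recover all skein sums of `D`, so those of the lassoed
  -- diagram can only agree if those of `D` do.
  · have h' : ¬ ∃ P : ℤ[X], ∀ b, (D.lasso p ccw).skeinSum ∅ b = P := by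
      rintro ⟨P, hP⟩
      refine h ⟨D.skeinSum ∅ (p, true), fun b => mul_left_cancel₀ hs0 ?_⟩
      have key : ∀ b, Polynomial.C (D.sign p : ℤ) * X ^ 3 * D.skeinSum ∅ b = P := fun b => by
        rw [← hP ((D.lasso p ccw).next.symm (GaussDiagram.lassoEnter p (D.next b)))]
        exact (D.skeinSum_lasso_of_next_eq p ccw (Equiv.apply_symm_apply _ _)).symm
      rw [key, key]
    rw [conway, conway, if_neg (not_isEmpty_of_nonempty _), if_neg (not_isEmpty_of_nonempty _),
      dif_neg h, dif_neg h', mul_zero]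

theorem lemma3p1 {C : Type*} [Fintype C] [DecidableEq C] (D : LinkDiagram C) (p : C) :
    (D.sign p = -1 → (D.lasso p true).conway = -X ^ 3 * D.conway ∧
      (D.lasso p false).conway = -X ^ 3 * D.conway) ∧
    (D.sign p = 1 → (D.lasso p true).conway = X ^ 3 * D.conway ∧
      (D.lasso p false).conway = X ^ 3 * D.conway) := by
  refine ⟨fun h => ?_, fun h => ?_⟩ <;> simp [D.conway_lasso, h]
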